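/- Let $n\ge 0$ and let $\mathfrak g_n$ be either $\mathfrak{gl}(n,\mathbb C)$ or $\mathfrak{so}(n,\mathbb C)$, the latter realised as the complex skew-symmetric $n\times n$ matrices. For $1\le i\le n$ let $\mathfrak g_i$ be $\mathfrak{gl}(i,\mathbb C)$, resp. $\mathfrak{so}(i,\mathbb C)$, let $r_i$ be its rank ($r_i=i$, resp. $r_i=\lfloor i/2\rfloor$), and for $x\in\mathfrak g_n$ let $x_i\in\mathfrak g_i$ be the top left $i\times i$ corner of $x$. For $1\le j\le r_i$ define $f_{i,j}:\mathfrak g_n\to\mathbb C$ by $f_{i,j}(x)=\operatorname{tr}(x_i^{\,j})$ in the case of $\mathfrak{gl}$, and, in the case of $\mathfrak{so}$, by $f_{i,j}(x)=\operatorname{tr}(x_i^{\,2j})$, except that $f_{2l,l}(x)=\operatorname{Pf}(x_{2l})$ is the Pfaffian. For a holomorphic function $f$ on $\mathfrak g_n$ let $\nabla f(x)\in\mathfrak g_n$ be defined by $\operatorname{tr}(\nabla f(x)z)=(df)_x(z)$ for all $z\in\mathfrak g_n$; the Hamiltonian vector field of $f$ for the Lie–Poisson structure is $(\xi_f)_x=[x,\nabla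 f(x)]$. The vector fields $\xi_{f_{i,j}}$, $1\le i\le n-1$, $1\le j\le r_i$, have commuting flows defined for all complex times. Let $A$ be the group of all tuples $(t_{i,j})_{1\le i\le n-1,\,1\le j\le r_i}$ of complex numbers, where $(t_{i,j})$ acts on $\mathfrak g_n$ by the composition of the time-$t_{i,j}$ flows of the $\xi_{f_{i,j}}$. The dimension of the orbit $A\cdot x$ is the complex dimension of its tangent space at $x$, the image of the differential at $0$ of the orbit map $t\mapsto t\cdot x$. Let $d$ be half the dimension of a regular adjoint orbit in $\mathfrak g_n$, that is, of the adjoint orbit of an element whose centralizer in $\mathfrak g_n$ has dimension $r_n$. Call $x\in\mathfrak g_n$ strongly regular if the differentials $(df_{i,j})_x$, $1\le i\le n$, $1\le j\le r_i$, are linearly independent. Then for every $x\in\mathfrak g_n$ one has $\dim(A\cdot x)\le d$, and $x$ is strongly regular if and only if $\dim(A\cdot x)=d$. -/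

import Mathlib

open Matrix

attribute [local instance] LieRing.ofAssociativeRing

noncomputable section

namespace GelfandZeitlin

/-- The two families of complex Lie algebras: `gl n` and `so n`. -/
inductive Family where
  | gl
  | so

/-- The Lie algebra `𝔤ₙ`: all complex `n × n` matrices, or the skew-symmetric ones. -/
def lieAlg : Family → (n : ℕ) → LieSubalgebra ℂ (Matrix (Fin n) (Fin n) ℂ)
  | .gl, _ => ⊤
  | .so, n => LieAlgebra.Orthogonal.so (Fin n) ℂ

/-- The rank of `𝔤ᵢ` (the dimension of a Cartan subalgebra). -/
def rank : Family → ℕ → ℕ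
  | .gl, i => i
  | .so, i => i / 2

/-- The Pfaffian of an `m × m` matrix for `m = 2l` even, with the normalisation
`Pf A = 1 / (2 ^ l * l!) * ∑ σ, sign σ * ∏ k < l, A (σ (2k)) (σ (2k+1))`
(it is only used for even `m`). -/
def pfaffian {m : ℕ} (A : Matrix (Fin m) (Fin m) ℂ) : ℂ :=
  ((2 : ℂ) ^ (m / 2) * ((m / 2).factorial : ℂ))⁻¹ *
    ∑ σ : Equiv.Perm (Fin m), ((Equiv.Perm.sign σ : ℤ) : ℂ) *
      ∏ k : Fin (m / 2),
        A (σ ⟨2 * k.1, by have := k.2; omega⟩) (σ ⟨2 * k.1 + 1, by have := k.2; omega⟩)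

/-- The `j`-th fundamental invariant on `i × i` matrices, `1 ≤ j ≤ rank i`:
`tr (y ^ j)` for `gl i`; for `so i` it is `tr (y ^ (2 * j))`, except that for `i = 2l`
the last one (`j = l`) is the Pfaffian. -/
def invariant : Family → (i j : ℕ) → Matrix (Fin i) (Fin i) ℂ → ℂ
  | .gl, _, j, y => (y ^ j).trace
  | .so, i, j, y => if i = 2 * j then pfaffian y else (y ^ (2 * j)).trace

/-- The `i × i` cutoff (top left corner) of an `n × n` matrix, `i ≤ n`. -/
def cutoff {n i : ℕ} (h : i ≤ n) (x : Matrix (Fin n) (Fin n) ℂ) : Matrix (Fin i) (Fin i) ℂ :=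
  x.submatrix (Fin.castLE h) (Fin.castLE h)

/-- Index set of the pairs `(i, j)` with `1 ≤ i ≤ m`, `1 ≤ j ≤ rank i`; the pair `(i, j)` is
encoded by `⟨i - 1, j - 1⟩`. -/
abbrev Index (F : Family) (m : ℕ) : Type := Σ i : Fin m, Fin (rank F (i.1 + 1))

/-- The function `f_{i,j}(x) = f_{i,j}(x_i)` on `𝔤ₙ`, for `1 ≤ i ≤ m ≤ n`. -/
def gzFun (F : Family) {n m : ℕ} (h : m ≤ n) (k : Index F m) (x : lieAlg F n) : ℂ :=
  invariant F (k.1.1 + 1) (k.2.1 + 1)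
    (cutoff (Nat.le_trans k.1.2 h) (x : Matrix (Fin n) (Fin n) ℂ))

/-- `x` is strongly regular: the differentials at `x` of all the `f_{i,j}`,
`1 ≤ i ≤ n`, `1 ≤ j ≤ rank i`, are linearly independent. -/
def StronglyRegular (F : Family) (n : ℕ) (x : lieAlg F n) : Prop :=
  LinearIndependent ℂ (fun k : Index F n => fderiv ℂ (gzFun F le_rfl k) x)

/-- The trace form `β(x, y) = tr (x y)` on `𝔤ₙ`. -/
def traceForm (F : Family) (n : ℕ) : LinearMap.BilinForm ℂ (lieAlg F n) :=
  ((LinearMap.mul ℂ (Matrix (Fin n) (Fin n) ℂ)).compr₂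
    (Matrix.traceLinearMap (Fin n) ℂ ℂ)).domRestrict₁₂
      (lieAlg F n).toSubmodule (lieAlg F n).toSubmodule

theorem traceForm_apply (F : Family) (n : ℕ) (x y : lieAlg F n) :
    traceForm F n x y =
      ((x : Matrix (Fin n) (Fin n) ℂ) * (y : Matrix (Fin n) (Fin n) ℂ)).trace := rfl

theorem conjTranspose_mem (F : Family) (n : ℕ) {x : Matrix (Fin n) (Fin n) ℂ}
    (hx : x ∈ lieAlg F n) : xᴴ ∈ lieAlg F n := by
  cases F with
  | gl => exact LieSubalgebra.mem_top _
  | so =>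
    have h : xᵀ = -x := (LieAlgebra.Orthogonal.mem_so (Fin n) ℂ x).1 hx
    refine (LieAlgebra.Orthogonal.mem_so (Fin n) ℂ xᴴ).2 ?_
    rw [← Matrix.conjTranspose_neg, ← h]
    rfl

open scoped ComplexOrder in
theorem traceForm_nondegenerate (F : Family) (n : ℕ) : (traceForm F n).Nondegenerate := by
  have hs : (traceForm F n).IsSymm :=
    ⟨fun x y => by
      rw [traceForm_apply, traceForm_apply]
      exact Matrix.trace_mul_comm _ _⟩
  refine (LinearMap.IsRefl.nondegenerate_iff_separatingLeft hs.isRefl).2 fun x hx => ?_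
  have h := hx ⟨_, conjTranspose_mem F n x.2⟩
  rw [traceForm_apply] at h
  exact Subtype.ext (Matrix.trace_mul_conjTranspose_self_eq_zero_iff.1 h)

/-- The gradient `∇f(x) ∈ 𝔤ₙ`, the unique element with `β(∇f(x), z) = (df)ₓ(z)` for all `z`. -/
def gradient {F : Family} {n : ℕ} (f : lieAlg F n → ℂ) (x : lieAlg F n) : lieAlg F n :=
  ((traceForm F n).toDual (traceForm_nondegenerate F n)).symm
    (fderiv ℂ f x : lieAlg F n →ₗ[ℂ] ℂ)

theorem traceForm_gradient {F : Family} {n : ℕ} (f : lieAlg F n → ℂ) (x z : lieAlg F n) :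
    traceForm F n (gradient f x) z = fderiv ℂ f x z :=
  LinearMap.BilinForm.apply_toDual_symm_apply ..

/-- The Hamiltonian vector field of `f` for the Lie-Poisson structure
`{f, g}(x) = β(x, [∇f(x), ∇g(x)])`, that is `(ξ_f)ₓ = [x, ∇f(x)]`. -/
def hamiltonianField {F : Family} {n : ℕ} (f : lieAlg F n → ℂ) (x : lieAlg F n) : lieAlg F n :=
  ⁅x, gradient f x⁆

/-- `γ` is a holomorphic integral curve, defined for all complex times, of the vector field `v`,
starting at `x`. -/
def IsEntireIntegralCurve {F : Family} {n : ℕ} (v : lieAlg F n → lieAlg F n) (x : lieAlg F n)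
    (γ : ℂ → lieAlg F n) : Prop :=
  γ 0 = x ∧ ∀ s : ℂ, HasDerivAt γ (v (γ s)) s

open Classical in
/-- The complex flow of `ξ_f`: the value at time `t` of the integral curve of `ξ_f` through `x`
(and `x` itself if there is no integral curve for all complex times). -/
def hamiltonianFlow {F : Family} {n : ℕ} (f : lieAlg F n → ℂ) (t : ℂ) (x : lieAlg F n) :
    lieAlg F n :=
  if h : ∃ γ : ℂ → lieAlg F n, IsEntireIntegralCurve (hamiltonianField f) x γ then
    h.choose t
  else x

/-- The group `A`: the vector group `ℂ ^ {(i, j) | 1 ≤ i ≤ n - 1, 1 ≤ j ≤ rank i}`. -/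
abbrev GroupA (F : Family) (n : ℕ) : Type := Index F (n - 1) → ℂ

/-- The pairs `(i, j)`, `i ≤ m`, in lexicographic order. -/
def indexList (F : Family) (m : ℕ) : List (Index F m) :=
  (List.finRange m).flatMap fun i => (List.finRange (rank F (i.1 + 1))).map fun j => ⟨i, j⟩

/-- The action of `A` on `𝔤ₙ` that integrates the Hamiltonian vector fields of the `f_{i,j}`,
`1 ≤ i ≤ n - 1`: the element `t ∈ A` acts by the composition of the time `t_{i,j}` flows of
the `ξ_{f_{i,j}}` (these flows commute, the order is immaterial). -/
def act {F : Family} {n : ℕ} (t : GroupA F n) (x : lieAlg F n) : lieAlg F n :=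
  (indexList F (n - 1)).foldr
    (fun k y => hamiltonianFlow (gzFun F (Nat.sub_le n 1) k) (t k) y) x

/-- The tangent space at `x` of the orbit `A · x`: the image of the differential at `0 ∈ A` of
the orbit map `t ↦ t · x`. -/
def orbitTangentSpace {F : Family} {n : ℕ} (x : lieAlg F n) : Submodule ℂ (lieAlg F n) :=
  LinearMap.range (fderiv ℂ (fun t : GroupA F n => act t x) 0 : GroupA F n →ₗ[ℂ] lieAlg F n)

/-- The (complex) dimension of the orbit `A · x`. -/
def orbitDim {F : Family} {n : ℕ} (x : lieAlg F n) : ℕ :=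
  Module.finrank ℂ (orbitTangentSpace x)

/-- `y` is regular: its centralizer in `𝔤ₙ` has dimension equal to the rank of `𝔤ₙ`. -/
def IsRegular {F : Family} {n : ℕ} (y : lieAlg F n) : Prop :=
  Module.finrank ℂ (LinearMap.ker (LieAlgebra.ad ℂ (lieAlg F n) y)) = rank F n

/-- The dimension of the adjoint orbit of `y`, whose tangent space at `y` is `[𝔤ₙ, y]`. -/
def adjointOrbitDim {F : Family} {n : ℕ} (y : lieAlg F n) : ℕ :=
  Module.finrank ℂ (LinearMap.range (LieAlgebra.ad ℂ (lieAlg F n) y))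

/-- The number `d`: half the (common) dimension of the regular adjoint orbits of `𝔤ₙ`. -/
def halfRegularOrbitDim (F : Family) (n : ℕ) : ℕ :=
  sSup {m : ℕ | ∃ y : lieAlg F n, IsRegular y ∧ adjointOrbitDim y = m} / 2

end GelfandZeitlin

end

/-! The gradient of an invariant at the corner `x_i` commutes with `x_i` (`gradInv_commute`). So the
flow of `f_{i,j}` keeps `x_i` fixed, the gradient of `f_{i,j}` is constant along it, and the flow is
conjugation by an exponential. Differentiating at time zero, the tangent space of the orbit is
spanned by the brackets `[x, ∇f_{i,j}(x)]` with `i < n` (`orbitTangentSpace_eq`). There are `∑_{i<n}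
r_i` of them, and this is `d` because `dim 𝔤ₙ = 2 ∑_{i<n} r_i + r_n`. The bound follows.

Let `L` be the span of the gradients with `i < n`. Equality of dimensions means that these gradients
are independent and that `L` meets the centralizer of `x` only in `0`. Strong regularity means that
they are independent, that the gradients with `i = n` are independent, and that `L` meets the span
of the latter only in `0`. Two facts reconcile the conditions.

(1) If the gradients with `i = n` are independent at `x`, they span the centralizer of `x`
(`span_gradInv_eq_ker_ad`), as in Kostant's criterion for regularity.

(2) If the gradients with `i < n` are independent and `L` meets the centralizer only in `0`, then
the gradients with `i = n` are independent (`linearIndependent_gradInv_of_lie`). Indeed a `z` in the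
centralizer that kills the last basis vector on both sides lives in the corner `𝔤ₙ₋₁` and commutes
with `x_{n-1}`. By (1) one level down it lies in `L`, so `z = 0`. The absence of such `z` bounds the
eigenspaces of `x`, which yields independence (`linearIndependent_gradInv`).

Both facts reduce to the degree of the minimal polynomial of `x`: it should be `n` for `gl n` and
for `so n` with `n` odd, and at least `n - 1` for `so n` with `n` even. In the last case the
Pfaffian gradient `G`, which satisfies `x G = Pf(x)/2`, makes up for the missing power of `x`. -/

noncomputable section

namespace GelfandZeitlin

/-! ### Conjugation by exponentials and the equation `δ' = [δ, c]`. -/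

section Conjugation

attribute [-instance] LieRing.ofAssociativeRing

variable {R : Type*} [NormedRing R] [NormedAlgebra ℂ R] [CompleteSpace R]

theorem hasDerivAt_exp_neg_smul (c : R) (s : ℂ) :
    HasDerivAt (fun s : ℂ => NormedSpace.exp (-(s • c))) (-(c * NormedSpace.exp (-(s • c)))) s := by
  have h := hasDerivAt_exp_smul_const' (𝕂 := ℂ) (-c) s
  simpa only [smul_neg, neg_mul] using h

theorem hasDerivAt_exp_conj (c x : R) (s : ℂ) :
    HasDerivAt (fun s : ℂ => NormedSpace.exp (-(s • c)) * x * NormedSpace.exp (s • c))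
      (NormedSpace.exp (-(s • c)) * x * NormedSpace.exp (s • c) * c -
        c * (NormedSpace.exp (-(s • c)) * x * NormedSpace.exp (s • c))) s := by
  have h := ((hasDerivAt_exp_neg_smul c s).mul_const x).mul (hasDerivAt_exp_smul_const (𝕂 := ℂ) c s)
  refine h.congr_deriv ?_
  simp only [neg_mul, mul_assoc]
  abel

theorem exp_smul_mul_exp_neg_smul (c : R) (s : ℂ) :
    NormedSpace.exp (s • c) * NormedSpace.exp (-(s • c)) = 1 := by
  let _ : NormedAlgebra ℚ R := NormedAlgebra.restrictScalars ℚ ℂ R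
  rw [← NormedSpace.exp_add_of_commute (Commute.neg_right (Commute.refl _)), add_neg_cancel,
    NormedSpace.exp_zero]

theorem exp_neg_smul_mul_exp_smul (c : R) (s : ℂ) :
    NormedSpace.exp (-(s • c)) * NormedSpace.exp (s • c) = 1 := by
  have h := exp_smul_mul_exp_neg_smul c (-s)
  rwa [neg_smul, neg_neg] at h

/-- A solution of `δ' = [δ, c]` is the orbit of its initial value under conjugation. -/
theorem eq_exp_conj_of_hasDerivAt {c : R} {δ : ℂ → R}
    (hδ : ∀ s, HasDerivAt δ (δ s * c - c * δ s) s) (s : ℂ) :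
    δ s = NormedSpace.exp (-(s • c)) * δ 0 * NormedSpace.exp (s • c) := by
  have hd : ∀ s, HasDerivAt
      (fun s : ℂ => NormedSpace.exp (s • c) * δ s * NormedSpace.exp (-(s • c))) 0 s := by
    intro s
    have h := ((hasDerivAt_exp_smul_const (𝕂 := ℂ) c s).mul (hδ s)).mul
      (hasDerivAt_exp_neg_smul c s)
    refine h.congr_deriv ?_
    simp only [Pi.mul_apply]
    noncomm_ring
  have hc := is_const_of_deriv_eq_zero (fun s => (hd s).differentiableAt)
    (fun s => (hd s).deriv) s 0
  simp only [zero_smul, neg_zero, NormedSpace.exp_zero, one_mul, mul_one] at hc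
  rw [← hc]
  simp only [mul_assoc, exp_neg_smul_mul_exp_smul, mul_one]
  rw [← mul_assoc, exp_neg_smul_mul_exp_smul, one_mul]

/-- Conjugation by `exp (s • c)` fixes whatever commutes with `c`. This is applied to the corner
`x_i` along a flow, with `c` the gradient of an invariant at `x_i`. -/
theorem eq_const_of_hasDerivAt {c : R} {δ : ℂ → R}
    (hδ : ∀ s, HasDerivAt δ (δ s * c - c * δ s) s) (hc : Commute (δ 0) c) (s : ℂ) :
    δ s = δ 0 := by
  have h : Commute (δ 0) (NormedSpace.exp (s • c)) := by
    exact (hc.smul_right s).exp_right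
  rw [eq_exp_conj_of_hasDerivAt hδ s, mul_assoc, h.eq, ← mul_assoc, exp_neg_smul_mul_exp_smul,
    one_mul]

variable {E : Type*} [NormedAddCommGroup E] [NormedSpace ℂ E]

/-- The derivative of `G` drops out because the scalar factor vanishes at time `0`. -/
theorem hasFDerivAt_exp_smul_zero {G : E → R} {x : E} (hG : DifferentiableAt ℂ G x) :
    HasFDerivAt (fun p : ℂ × E => NormedSpace.exp (p.1 • G p.2))
      ((ContinuousLinearMap.fst ℂ ℂ E).smulRight (G x)) (0, x) := by
  have h1 : HasFDerivAt (fun p : ℂ × E => p.1 • G p.2)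
      ((ContinuousLinearMap.fst ℂ ℂ E).smulRight (G x)) (0, x) := by
    have h : HasFDerivAt (fun p : ℂ × E => G p.2) _ (0, x) :=
      HasFDerivAt.comp (0, x) (f := fun p : ℂ × E => p.2) hG.hasFDerivAt hasFDerivAt_snd
    have := (hasFDerivAt_fst (𝕜 := ℂ) (p := ((0 : ℂ), x))).smul h
    refine this.congr_fderiv ?_
    ext p <;> simp
  have h2 : HasFDerivAt (NormedSpace.exp : R → R) (1 : R →L[ℂ] R) ((0 : ℂ) • G x) := by
    rw [zero_smul]; exact hasFDerivAt_exp_zero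
  exact HasFDerivAt.comp (0, x) (f := fun p : ℂ × E => p.1 • G p.2) h2 h1

theorem hasFDerivAt_exp_conj_zero {G : E → R} {x : E} (hG : DifferentiableAt ℂ G x)
    (ι : E →L[ℂ] R) :
    HasFDerivAt (fun p : ℂ × E =>
        NormedSpace.exp (-(p.1 • G p.2)) * ι p.2 * NormedSpace.exp (p.1 • G p.2))
      ((ContinuousLinearMap.fst ℂ ℂ E).smulRight (ι x * G x - G x * ι x) +
        ι.comp (ContinuousLinearMap.snd ℂ ℂ E)) (0, x) := by
  have h1 := hasFDerivAt_exp_smul_zero hG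
  have h2 := hasFDerivAt_exp_smul_zero hG.neg
  have h3 : HasFDerivAt (fun p : ℂ × E => ι p.2) (ι.comp (ContinuousLinearMap.snd ℂ ℂ E)) (0, x) :=
    (ι.comp (ContinuousLinearMap.snd ℂ ℂ E)).hasFDerivAt
  have h := (h2.mul' h3).mul' h1
  simp only [smul_neg, Pi.neg_apply] at h
  refine h.congr_fderiv ?_
  ext p <;> simp [sub_eq_add_neg]

end Conjugation

/-! ### First-order behaviour of composed flows. -/

section Composition

variable {E : Type*} [NormedAddCommGroup E] [NormedSpace ℂ E] {κ : Type*} [Fintype κ]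

/-- The differential at `0` of a composition of local flows. -/
theorem hasFDerivAt_foldr_flow {Φ : κ → ℂ × E → E} {ξ : κ → E} {x : E}
    (h0 : ∀ k, Φ k (0, x) = x)
    (hΦ : ∀ k, HasFDerivAt (Φ k) ((ContinuousLinearMap.fst ℂ ℂ E).smulRight (ξ k) +
      ContinuousLinearMap.snd ℂ ℂ E) (0, x)) (l : List κ) :
    l.foldr (fun k y => Φ k (0, y)) x = x ∧
    HasFDerivAt (fun t : κ → ℂ => l.foldr (fun k y => Φ k (t k, y)) x)
      ((l.map fun k => (ContinuousLinearMap.proj (R := ℂ) (φ := fun _ : κ => ℂ) k).smulRight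
        (ξ k)).sum) 0 := by
  induction l with
  | nil => exact ⟨rfl, by simpa using hasFDerivAt_const x (0 : κ → ℂ)⟩
  | cons k l ih =>
    refine ⟨by rw [List.foldr_cons, ih.1, h0], ?_⟩
    have h1 : HasFDerivAt (fun t : κ → ℂ => (t k, l.foldr (fun k y => Φ k (t k, y)) x)) _ 0 :=
      (ContinuousLinearMap.proj (R := ℂ) (φ := fun _ : κ => ℂ) k).hasFDerivAt.prodMk ih.2
    have h2 := hΦ k
    have h3 : ((0 : ℂ), x) = ((0 : κ → ℂ) k,
        l.foldr (fun k y => Φ k ((0 : κ → ℂ) k, y)) x) := by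
      simp only [Pi.zero_apply]; rw [ih.1]
    rw [h3] at h2
    have h4 := HasFDerivAt.comp (0 : κ → ℂ) h2 h1
    refine HasFDerivAt.congr_fderiv h4 ?_
    ext t
    simp

end Composition

/-! ### Corners, their embeddings, and gradients for the trace form. -/

section Cutoff

attribute [local instance] Matrix.linftyOpNormedRing Matrix.linftyOpNormedAlgebra

theorem mem_lieAlg_so {n : ℕ} {x : Matrix (Fin n) (Fin n) ℂ} :
    x ∈ lieAlg .so n ↔ xᵀ = -x :=
  LieAlgebra.Orthogonal.mem_so (Fin n) ℂ x

theorem transpose_coe_so {n : ℕ} (x : lieAlg .so n) :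
    (x : Matrix (Fin n) (Fin n) ℂ)ᵀ = -(x : Matrix (Fin n) (Fin n) ℂ) :=
  mem_lieAlg_so.1 x.2

instance instIsTopologicalAddGroupLieAlg (F : Family) (n : ℕ) :
    IsTopologicalAddGroup (lieAlg F n) :=
  inferInstanceAs (IsTopologicalAddGroup (lieAlg F n).toSubmodule)

/-- The inclusion of `𝔤ₙ` into the `n × n` matrices. -/
def inclusion (F : Family) (n : ℕ) : lieAlg F n →L[ℂ] Matrix (Fin n) (Fin n) ℂ :=
  (lieAlg F n).toSubmodule.subtypeL

@[simp]
theorem inclusion_apply {F : Family} {n : ℕ} (x : lieAlg F n) :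
    inclusion F n x = (x : Matrix (Fin n) (Fin n) ℂ) := rfl

/-- Derivatives are computed in the full matrix algebra; composing with such a `P` brings them back
to `𝔤ₙ`. -/
theorem exists_projection (F : Family) (n : ℕ) :
    ∃ P : Matrix (Fin n) (Fin n) ℂ →L[ℂ] lieAlg F n, ∀ x : lieAlg F n, P x = x := by
  obtain ⟨P, hP⟩ := (lieAlg F n).toSubmodule.subtype.exists_leftInverse_of_injective
    (Submodule.ker_subtype _)
  exact ⟨LinearMap.toContinuousLinearMap P, fun x => LinearMap.congr_fun hP x⟩

/-- The `n × i` matrix of the inclusion of the first `i` coordinates. -/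
def firstCoords {i n : ℕ} (h : i ≤ n) : Matrix (Fin n) (Fin i) ℂ :=
  (1 : Matrix (Fin n) (Fin n) ℂ).submatrix id (Fin.castLE h)

theorem transpose_firstCoords_mul {i n : ℕ} (h : i ≤ n) :
    (firstCoords h)ᵀ * firstCoords h = 1 := by
  ext a b
  simp [firstCoords, Matrix.mul_apply, Matrix.one_apply]

theorem cutoff_eq {i n : ℕ} (h : i ≤ n) (x : Matrix (Fin n) (Fin n) ℂ) :
    cutoff h x = (firstCoords h)ᵀ * (x : Matrix (Fin n) (Fin n) ℂ) * firstCoords h := by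
  ext a b
  simp [cutoff, firstCoords, Matrix.mul_apply, Matrix.one_apply]

theorem cutoff_mem (F : Family) {i n : ℕ} (h : i ≤ n) {x : Matrix (Fin n) (Fin n) ℂ}
    (hx : x ∈ lieAlg F n) : cutoff h x ∈ lieAlg F i := by
  cases F with
  | gl => exact LieSubalgebra.mem_top _
  | so =>
    rw [mem_lieAlg_so] at hx ⊢
    ext a b
    exact congr_fun (congr_fun hx (Fin.castLE h a)) (Fin.castLE h b)

theorem extend_mem (F : Family) {i n : ℕ} (h : i ≤ n) {a : Matrix (Fin i) (Fin i) ℂ}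
    (ha : a ∈ lieAlg F i) : firstCoords h * a * (firstCoords h)ᵀ ∈ lieAlg F n := by
  cases F with
  | gl => exact LieSubalgebra.mem_top _
  | so =>
    rw [mem_lieAlg_so] at ha ⊢
    simp [Matrix.transpose_mul, ha, Matrix.mul_assoc]

/-- The cutoff `𝔤ₙ → 𝔤ᵢ`. -/
def cut (F : Family) {i n : ℕ} (h : i ≤ n) : lieAlg F n →ₗ[ℂ] lieAlg F i where
  toFun x := ⟨cutoff h x, cutoff_mem F h x.2⟩
  map_add' _ _ := rfl
  map_smul' _ _ := rfl

/-- The embedding `𝔤ᵢ → 𝔤ₙ` as the top left corner. -/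
def extend (F : Family) {i n : ℕ} (h : i ≤ n) : lieAlg F i →ₗ[ℂ] lieAlg F n where
  toFun a := ⟨firstCoords h * (a : Matrix (Fin i) (Fin i) ℂ) * (firstCoords h)ᵀ, extend_mem F h a.2⟩
  map_add' a b := Subtype.ext (by simp [Matrix.mul_add, Matrix.add_mul])
  map_smul' c a := Subtype.ext (by simp)

@[simp]
theorem coe_cut (F : Family) {i n : ℕ} (h : i ≤ n) (x : lieAlg F n) :
    (cut F h x : Matrix (Fin i) (Fin i) ℂ) = cutoff h x := rfl

@[simp]
theorem coe_extend (F : Family) {i n : ℕ} (h : i ≤ n) (a : lieAlg F i) :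
    (extend F h a : Matrix (Fin n) (Fin n) ℂ) =
      firstCoords h * (a : Matrix (Fin i) (Fin i) ℂ) * (firstCoords h)ᵀ := rfl

theorem cut_extend (F : Family) {i n : ℕ} (h : i ≤ n) (a : lieAlg F i) :
    cut F h (extend F h a) = a := by
  refine Subtype.ext ?_
  have e := transpose_firstCoords_mul h
  rw [coe_cut, coe_extend, cutoff_eq]
  calc _ = ((firstCoords h)ᵀ * firstCoords h) * (a : Matrix (Fin i) (Fin i) ℂ) *
        ((firstCoords h)ᵀ * firstCoords h) := by simp only [Matrix.mul_assoc]
    _ = _ := by rw [e, Matrix.one_mul, Matrix.mul_one]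

theorem extend_injective (F : Family) {i n : ℕ} (h : i ≤ n) :
    Function.Injective (extend F h) :=
  Function.LeftInverse.injective (cut_extend F h)

theorem coe_lie {F : Family} {n : ℕ} (x y : lieAlg F n) :
    ((⁅x, y⁆ : lieAlg F n) : Matrix (Fin n) (Fin n) ℂ) =
      (x : Matrix (Fin n) (Fin n) ℂ) * y - (y : Matrix (Fin n) (Fin n) ℂ) * x := by
  rw [LieSubalgebra.coe_bracket, LieRing.of_associative_ring_bracket]

/-- With `J` the inclusion of the first coordinates, everything follows from `Jᵀ J = 1`: the corner
of `[x, J a Jᵀ]` only sees the corner of `x`. -/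
theorem cut_lie_extend (F : Family) {i n : ℕ} (h : i ≤ n) (x : lieAlg F n) (a : lieAlg F i) :
    cut F h ⁅x, extend F h a⁆ = ⁅cut F h x, a⁆ := by
  refine Subtype.ext ?_
  have e := transpose_firstCoords_mul h
  rw [coe_cut, coe_lie, coe_lie, coe_extend, coe_cut, cutoff_eq, cutoff_eq, Matrix.mul_sub,
    Matrix.sub_mul]
  congr 1
  · calc _ = (firstCoords h)ᵀ * (x : Matrix (Fin n) (Fin n) ℂ) * firstCoords h * (a : Matrix (Fin i) (Fin i) ℂ) *
        ((firstCoords h)ᵀ * firstCoords h) := by simp only [Matrix.mul_assoc]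
      _ = _ := by rw [e, Matrix.mul_one]
  · calc _ = ((firstCoords h)ᵀ * firstCoords h) * (a : Matrix (Fin i) (Fin i) ℂ) *
        ((firstCoords h)ᵀ * (x : Matrix (Fin n) (Fin n) ℂ) * firstCoords h) := by simp only [Matrix.mul_assoc]
      _ = _ := by rw [e, Matrix.one_mul]

/-- Embedding and cutoff are adjoint for the trace forms, so the gradient of a function of `x_i` is
the embedded gradient on `𝔤ᵢ`. -/
theorem traceForm_extend (F : Family) {i n : ℕ} (h : i ≤ n) (a : lieAlg F i) (z : lieAlg F n) :
    traceForm F n (extend F h a) z = traceForm F i a (cut F h z) := by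
  rw [traceForm_apply, traceForm_apply, coe_extend, coe_cut, cutoff_eq, Matrix.mul_assoc,
    Matrix.mul_assoc, Matrix.trace_mul_comm]
  simp only [Matrix.mul_assoc]

theorem eq_of_traceForm_eq {F : Family} {n : ℕ} {x y : lieAlg F n}
    (h : ∀ z, traceForm F n x z = traceForm F n y z) : x = y := by
  rw [← sub_eq_zero]
  refine (traceForm_nondegenerate F n).1 _ fun z => ?_
  rw [map_sub, LinearMap.sub_apply, h, sub_self]

/-- The invariant `f_{i,j}` as a function on `𝔤ᵢ`. -/
def invFun (F : Family) (i j : ℕ) (y : lieAlg F i) : ℂ :=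
  invariant F i j (y : Matrix (Fin i) (Fin i) ℂ)

/-- The gradient of the invariant `f_{i,j}` on `𝔤ᵢ`. -/
def gradInv (F : Family) (i j : ℕ) (y : lieAlg F i) : lieAlg F i :=
  gradient (invFun F i j) y

open scoped ContDiff in
theorem contDiff_pfaffian (n : ℕ) :
    ContDiff ℂ ω (pfaffian : Matrix (Fin n) (Fin n) ℂ → ℂ) := by
  have he : ∀ a b : Fin n, ContDiff ℂ ω (fun A : Matrix (Fin n) (Fin n) ℂ => A a b) := fun a b =>
    (LinearMap.toContinuousLinearMap (Matrix.entryLinearMap ℂ ℂ a b)).contDiff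
  unfold pfaffian
  refine contDiff_const.mul (ContDiff.sum fun σ _ => contDiff_const.mul ?_)
  exact contDiff_prod fun k _ => he _ _

open scoped ContDiff in
theorem contDiff_trace_pow (n j : ℕ) :
    ContDiff ℂ ω (fun A : Matrix (Fin n) (Fin n) ℂ => (A ^ j).trace) :=
  (LinearMap.toContinuousLinearMap (Matrix.traceLinearMap (Fin n) ℂ ℂ)).contDiff.comp
    (contDiff_id.pow j)

open scoped ContDiff in
theorem contDiff_invariant (F : Family) (i j : ℕ) : ContDiff ℂ ω (invariant F i j) := by
  cases F with
  | gl => exact contDiff_trace_pow i j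
  | so =>
    by_cases h : i = 2 * j
    · have : invariant .so i j = pfaffian := by
        funext y; simp [invariant, h]
      rw [this]
      exact contDiff_pfaffian i
    · have : invariant .so i j = fun y => (y ^ (2 * j)).trace := by
        funext y; simp [invariant, h]
      rw [this]
      exact contDiff_trace_pow i _

open scoped ContDiff in
theorem contDiff_invFun (F : Family) (i j : ℕ) : ContDiff ℂ ω (invFun F i j) :=
  (contDiff_invariant F i j).comp (inclusion F i).contDiff

open scoped ContDiff in
theorem differentiable_linear_fderiv {E E' : Type*} [NormedAddCommGroup E] [NormedSpace ℂ E]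
    [FiniteDimensional ℂ E] [NormedAddCommGroup E'] [NormedSpace ℂ E'] {f : E → ℂ}
    (hf : ContDiff ℂ ω f) (L : (E →L[ℂ] ℂ) →ₗ[ℂ] E') :
    Differentiable ℂ fun x => L (fderiv ℂ f x) := by
  have h1 : Differentiable ℂ (fderiv ℂ f) :=
    (hf.fderiv_right (m := 1) (by simp)).differentiable (by simp)
  have h2 : Differentiable ℂ L := (LinearMap.toContinuousLinearMap L).differentiable
  exact h2.comp h1

theorem differentiable_gradInv (F : Family) (i j : ℕ) : Differentiable ℂ (gradInv F i j) := by
  let L : (lieAlg F i →L[ℂ] ℂ) →ₗ[ℂ] lieAlg F i :=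
    { toFun := fun φ => ((traceForm F i).toDual (traceForm_nondegenerate F i)).symm
        (φ : lieAlg F i →ₗ[ℂ] ℂ)
      map_add' := fun a b => by rw [ContinuousLinearMap.toLinearMap_add, map_add]
      map_smul' := fun a b => by rw [ContinuousLinearMap.toLinearMap_smul, map_smul]; rfl }
  exact differentiable_linear_fderiv (contDiff_invFun F i j) L

theorem hasFDerivAt_trace_pow {n : ℕ} (j : ℕ) (A : Matrix (Fin n) (Fin n) ℂ) :
    ∃ D : Matrix (Fin n) (Fin n) ℂ →L[ℂ] ℂ,
      HasFDerivAt (fun A : Matrix (Fin n) (Fin n) ℂ => (A ^ j).trace) D A ∧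
      ∀ z, D z = j * (A ^ (j - 1) * z).trace := by
  have h1 := (hasFDerivAt_id (𝕜 := ℂ) A).pow' j
  have h2 := ((LinearMap.toContinuousLinearMap (Matrix.traceLinearMap (Fin n) ℂ ℂ)).hasFDerivAt).comp
    A h1
  refine ⟨_, h2, fun z => ?_⟩
  have h3 : ∀ k ∈ Finset.range j, (A ^ (j.pred - k) * (z * A ^ k)).trace =
      (A ^ (j - 1) * z).trace := by
    intro k hk
    rw [← Matrix.mul_assoc, Matrix.trace_mul_comm, ← Matrix.mul_assoc, ← pow_add]
    congr 3
    have := Finset.mem_range.1 hk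
    simp only [Nat.pred_eq_sub_one]
    omega
  have h4 : (∑ k ∈ Finset.range j, (MulOpposite.op (A ^ k) • A ^ (j.pred - k) •
      ContinuousLinearMap.id ℂ (Matrix (Fin n) (Fin n) ℂ))) z =
      ∑ k ∈ Finset.range j, A ^ (j.pred - k) * (z * A ^ k) := by
    refine (_root_.sum_apply _ _ _).trans (Finset.sum_congr rfl fun k _ => ?_)
    exact Matrix.mul_assoc (A ^ (j.pred - k)) z (A ^ k)
  refine (congr_arg Matrix.trace h4).trans ?_
  rw [Matrix.trace_sum, Finset.sum_congr rfl h3, Finset.sum_const, Finset.card_range, nsmul_eq_mul]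

theorem traceForm_gradInv (F : Family) (i j : ℕ) (y z : lieAlg F i)
    {D : Matrix (Fin i) (Fin i) ℂ →L[ℂ] ℂ}
    (hD : HasFDerivAt (invariant F i j) D (y : Matrix (Fin i) (Fin i) ℂ)) :
    traceForm F i (gradInv F i j y) z = D z := by
  have h : HasFDerivAt (invFun F i j) (D.comp (inclusion F i)) y :=
    HasFDerivAt.comp y (f := inclusion F i) hD (inclusion F i).hasFDerivAt
  rw [gradInv, traceForm_gradient]
  exact DFunLike.congr_fun h.fderiv z

end Cutoff

/-! ### Transformation of the Pfaffian under congruence. -/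

section Pfaffian

attribute [local instance] Matrix.linftyOpNormedRing Matrix.linftyOpNormedAlgebra

variable {m : ℕ}

/-- The indices of an even-dimensional space grouped in consecutive pairs. -/
def pairEquiv (hm : Even m) : Fin (m / 2) × Fin 2 ≃ Fin m :=
  finProdFinEquiv.trans (finCongr (Nat.div_mul_cancel hm.two_dvd))

theorem pairEquiv_zero (hm : Even m) (k : Fin (m / 2)) :
    pairEquiv hm (k, 0) = ⟨2 * k.1, by have := k.2; omega⟩ :=
  Fin.ext (by simp [pairEquiv, finProdFinEquiv])

theorem pairEquiv_one (hm : Even m) (k : Fin (m / 2)) :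
    pairEquiv hm (k, 1) = ⟨2 * k.1 + 1, by have := k.2; omega⟩ :=
  Fin.ext (by simp [pairEquiv, finProdFinEquiv]; omega)

theorem pfaffian_eq (hm : Even m) (A : Matrix (Fin m) (Fin m) ℂ) :
    pfaffian A = ((2 : ℂ) ^ (m / 2) * ((m / 2).factorial : ℂ))⁻¹ *
      ∑ σ : Equiv.Perm (Fin m), ((Equiv.Perm.sign σ : ℤ) : ℂ) *
        ∏ k : Fin (m / 2), A (σ (pairEquiv hm (k, 0))) (σ (pairEquiv hm (k, 1))) := by
  simp only [pairEquiv_zero, pairEquiv_one]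
  rfl

theorem prod_pairEquiv (hm : Even m) (f : Fin m → ℂ) :
    ∏ p, f p = ∏ k, f (pairEquiv hm (k, 0)) * f (pairEquiv hm (k, 1)) := by
  rw [← (pairEquiv hm).prod_comp f, Fintype.prod_prod_type]
  simp

/-- The function on all indices given by its values on the consecutive pairs. -/
def pairFun (hm : Even m) (φ : Fin (m / 2) → Fin m × Fin m) (p : Fin m) : Fin m :=
  if ((pairEquiv hm).symm p).2 = 0 then (φ ((pairEquiv hm).symm p).1).1
  else (φ ((pairEquiv hm).symm p).1).2

/-- Expanding every entry of `g A gᵀ` and summing over permutations first leaves, for each choice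
`φ` of indices, the determinant of the columns of `g` selected by `φ`. That determinant is `det g`
times the same one for the identity. The remaining factor does not involve `g`, so comparison with
`g = 1` identifies it as the Pfaffian of `A`. -/
theorem pfaffian_conj_aux (hm : Even m) (g A : Matrix (Fin m) (Fin m) ℂ) :
    pfaffian (g * A * gᵀ) = g.det * (((2 : ℂ) ^ (m / 2) * ((m / 2).factorial : ℂ))⁻¹ *
      ∑ φ : Fin (m / 2) → Fin m × Fin m, (∏ k, A (φ k).1 (φ k).2) *
        ((1 : Matrix (Fin m) (Fin m) ℂ).submatrix id (pairFun hm φ)).det) := by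
  have hdet : ∀ φ, g.det * ((1 : Matrix (Fin m) (Fin m) ℂ).submatrix id (pairFun hm φ)).det =
      (g.submatrix id (pairFun hm φ)).det := by
    intro φ
    rw [← Matrix.det_mul]
    congr 1
    ext a b
    simp [Matrix.mul_apply, Matrix.one_apply]
  have hentry : ∀ a b, (g * A * gᵀ) a b =
      ∑ c : Fin m × Fin m, A c.1 c.2 * (g a c.1 * g b c.2) := by
    intro a b
    rw [Fintype.sum_prod_type, Matrix.mul_apply, Finset.sum_comm]
    refine Finset.sum_congr rfl fun d _ => ?_
    rw [Matrix.mul_apply, Finset.sum_mul]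
    refine Finset.sum_congr rfl fun c _ => ?_
    rw [Matrix.transpose_apply]
    ring
  rw [pfaffian_eq hm, mul_left_comm, Finset.mul_sum]
  simp only [hentry, Finset.prod_univ_sum, Fintype.piFinset_univ, Finset.mul_sum]
  rw [Finset.sum_comm]
  refine Finset.sum_congr rfl fun φ _ => ?_
  rw [← Finset.mul_sum, mul_left_comm, mul_left_comm g.det, mul_left_comm g.det, hdet]
  congr 1
  rw [Matrix.det_apply', Finset.mul_sum]
  refine Finset.sum_congr rfl fun σ _ => ?_
  rw [prod_pairEquiv hm, Finset.prod_mul_distrib]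
  simp [pairFun]
  ring

theorem pfaffian_conj (hm : Even m) (g A : Matrix (Fin m) (Fin m) ℂ) :
    pfaffian (g * A * gᵀ) = g.det * pfaffian A := by
  have h := pfaffian_conj_aux hm 1 A
  rw [Matrix.one_mul, Matrix.transpose_one, Matrix.mul_one, Matrix.det_one, one_mul] at h
  rw [pfaffian_conj_aux hm g A, h]

theorem hasDerivAt_det_one_add_smul (a : Matrix (Fin m) (Fin m) ℂ) :
    HasDerivAt (fun t : ℂ => (1 + t • a).det) a.trace 0 := by
  have h : (fun t : ℂ => (1 + t • a).det) = fun t => 1 + a.trace * t +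
      (Matrix.det (1 + (Polynomial.X : Polynomial ℂ) • a.map Polynomial.C)).divX.divX.eval t *
        t ^ 2 := funext fun t => Matrix.det_one_add_smul t a
  rw [h]
  have h1 : HasDerivAt (fun t : ℂ => 1 + a.trace * t) a.trace 0 := by
    simpa using ((hasDerivAt_id (0 : ℂ)).const_mul a.trace).const_add 1
  have h2 := ((Matrix.det (1 + (Polynomial.X : Polynomial ℂ) •
    a.map Polynomial.C)).divX.divX.hasDerivAt (0 : ℂ)).mul (hasDerivAt_pow 2 (0 : ℂ))
  exact (h1.add h2).congr_deriv (by simp)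

theorem hasFDerivAt_pfaffian (A : Matrix (Fin m) (Fin m) ℂ) :
    HasFDerivAt (pfaffian : Matrix (Fin m) (Fin m) ℂ → ℂ) (fderiv ℂ pfaffian A) A :=
  ((contDiff_pfaffian m).differentiable (by simp) A).hasFDerivAt

/-- Differentiate `pfaffian_conj` along `g = 1 + t a` at `t = 0`. -/
theorem fderiv_pfaffian_infinitesimal (hm : Even m) (a A : Matrix (Fin m) (Fin m) ℂ) :
    fderiv ℂ pfaffian A (a * A + A * aᵀ) = a.trace * pfaffian A := by
  have h1 : HasDerivAt (fun t : ℂ => (1 + t • a) * A * (1 + t • a)ᵀ) (a * A + A * aᵀ) 0 := by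
    have h0 : HasDerivAt (fun t : ℂ => 1 + t • a) a 0 := by
      exact (((hasDerivAt_id (0 : ℂ)).smul_const a).const_add 1).congr_deriv (by simp)
    have h0' : HasDerivAt (fun t : ℂ => 1 + t • aᵀ) aᵀ 0 := by
      exact (((hasDerivAt_id (0 : ℂ)).smul_const aᵀ).const_add 1).congr_deriv (by simp)
    have h2 := (h0.mul_const A).mul h0'
    have h3 : (fun t : ℂ => (1 + t • a) * A * (1 + t • a)ᵀ) =
        (fun t : ℂ => (1 + t • a) * A) * fun t : ℂ => 1 + t • aᵀ := by
      funext t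
      simp
    rw [h3]
    exact h2.congr_deriv (by simp)
  have h2 : HasFDerivAt (pfaffian : Matrix (Fin m) (Fin m) ℂ → ℂ) (fderiv ℂ pfaffian A)
      ((1 + (0 : ℂ) • a) * A * (1 + (0 : ℂ) • a)ᵀ) := by
    simpa using hasFDerivAt_pfaffian A
  have h3 := h2.comp_hasDerivAt (0 : ℂ) h1
  have h4 := (hasDerivAt_det_one_add_smul a).mul_const (pfaffian A)
  refine h3.unique (h4.congr_of_eventuallyEq (Filter.Eventually.of_forall fun t => ?_))
  exact pfaffian_conj hm _ _

end Pfaffian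

/-! ### The Pfaffian gradient, and non-vanishing of the Pfaffian on invertible skew matrices. -/

section PfaffianGradient

attribute [local instance] Matrix.linftyOpNormedRing Matrix.linftyOpNormedAlgebra

variable {m : ℕ}

/-- The infinitesimal congruence identity is tested in the direction `a A + A aᵀ`. By skewness both
summands contribute `tr (a A G)`, and `a` is arbitrary. -/
theorem mul_pfaffian_gradient (hm : Even m) {A G : Matrix (Fin m) (Fin m) ℂ} (hA : Aᵀ = -A)
    (hG : Gᵀ = -G) (h : ∀ z, zᵀ = -z → (G * z).trace = fderiv ℂ pfaffian A z) :
    A * G = (pfaffian A / 2) • 1 := by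
  refine Matrix.ext_iff_trace_mul_left.2 fun a => ?_
  have h1 := h (a * A + A * aᵀ) (by simp [Matrix.transpose_mul, hA])
  rw [fderiv_pfaffian_infinitesimal hm, Matrix.mul_add, Matrix.trace_add] at h1
  have h2 : (G * (A * aᵀ)).trace = (a * (A * G)).trace := by
    rw [← Matrix.trace_transpose]
    simp [Matrix.transpose_mul, hA, hG, Matrix.mul_assoc]
  have h3 : (G * (a * A)).trace = (a * (A * G)).trace := by
    rw [Matrix.trace_mul_comm, Matrix.mul_assoc]
  rw [h2, h3] at h1
  rw [Matrix.mul_smul, Matrix.mul_one, Matrix.trace_smul, smul_eq_mul]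
  linear_combination h1 / 2

theorem pfaffian_gradient_mul (hm : Even m) {A G : Matrix (Fin m) (Fin m) ℂ} (hA : Aᵀ = -A)
    (hG : Gᵀ = -G) (h : ∀ z, zᵀ = -z → (G * z).trace = fderiv ℂ pfaffian A z) :
    G * A = (pfaffian A / 2) • 1 := by
  have h1 := congr_arg Matrix.transpose (mul_pfaffian_gradient hm hA hG h)
  simpa [Matrix.transpose_mul, hA, hG] using h1

/-- The sign of the pair `(i, j)` of elements of a two element set. -/
def pairSign (i j : Fin 2) : ℂ := if i = 0 ∧ j = 1 then 1 else if i = 1 ∧ j = 0 then -1 else 0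

/-- The standard non-degenerate skew-symmetric matrix. -/
def standardSkew (hm : Even m) : Matrix (Fin m) (Fin m) ℂ := fun a b =>
  if ((pairEquiv hm).symm a).1 = ((pairEquiv hm).symm b).1 then
    pairSign ((pairEquiv hm).symm a).2 ((pairEquiv hm).symm b).2 else 0

theorem pairSign_swap (i j : Fin 2) : pairSign j i = -pairSign i j := by
  fin_cases i <;> fin_cases j <;> simp [pairSign]

theorem transpose_standardSkew (hm : Even m) : (standardSkew hm)ᵀ = -standardSkew hm := by
  ext a b
  simp only [Matrix.transpose_apply, Matrix.neg_apply, standardSkew, eq_comm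
    (a := ((pairEquiv hm).symm b).1)]
  split_ifs
  · rw [pairSign_swap]
  · simp

theorem pairSign_perm (ε : Equiv.Perm (Fin 2)) :
    pairSign (ε 0) (ε 1) = ((Equiv.Perm.sign ε : ℤ) : ℂ) := by
  have h : ∀ ε : Equiv.Perm (Fin 2), (ε 0 = 0 ∧ ε 1 = 1 ∧ Equiv.Perm.sign ε = 1) ∨
      (ε 0 = 1 ∧ ε 1 = 0 ∧ Equiv.Perm.sign ε = -1) := by decide
  rcases h ε with ⟨h0, h1, h2⟩ | ⟨h0, h1, h2⟩ <;> simp [h0, h1, h2, pairSign]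

/-- A permutation that preserves the pairs is a permutation of the pairs followed or preceded by
flips inside them. Moving the pairs has sign `1`, since it acts on both members at once, and the
flips contribute their signs once from `sign τ` and once from the entries, so everything cancels. -/
theorem standardSkew_term {k : ℕ} (τ : Equiv.Perm (Fin k × Fin 2)) :
    ((Equiv.Perm.sign τ : ℤ) : ℂ) * ∏ i, (if (τ (i, 0)).1 = (τ (i, 1)).1 then
      pairSign (τ (i, 0)).2 (τ (i, 1)).2 else 0) =
    if ∀ i, (τ (i, 0)).1 = (τ (i, 1)).1 then 1 else 0 := by
  split_ifs with h
  · have hfst : ∀ i j, (τ (i, j)).1 = (τ (i, 0)).1 := by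
      intro i j
      fin_cases j
      · rfl
      · exact (h i).symm
    have hπ : Function.Bijective fun i => (τ (i, 0)).1 := by
      refine (Finite.injective_iff_bijective).1 (Finite.injective_iff_surjective.2 fun q => ?_)
      obtain ⟨⟨i, j⟩, hij⟩ := τ.surjective (q, 0)
      exact ⟨i, by simp only [← hfst i j, hij]⟩
    let π : Equiv.Perm (Fin k) := Equiv.ofBijective _ hπ
    have hε : ∀ i, Function.Bijective fun j => (τ (i, j)).2 := by
      intro i
      refine (Finite.injective_iff_bijective).1 fun j j' hj => ?_
      have : τ (i, j) = τ (i, j') := Prod.ext ((hfst i j).trans (hfst i j').symm) hj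
      exact (Prod.ext_iff.1 (τ.injective this)).2
    let ε : Fin k → Equiv.Perm (Fin 2) := fun i => Equiv.ofBijective _ (hε i)
    have hτ : τ = Equiv.prodCongrLeft (fun _ : Fin 2 => π) * Equiv.prodCongrRight ε := by
      ext1 ⟨i, j⟩
      exact Prod.ext (hfst i j) rfl
    have hprod : ∀ i, (if (τ (i, 0)).1 = (τ (i, 1)).1 then
        pairSign (τ (i, 0)).2 (τ (i, 1)).2 else 0) = ((Equiv.Perm.sign (ε i) : ℤ) : ℂ) := by
      intro i
      rw [if_pos (h i), ← pairSign_perm]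
      rfl
    have hs : Equiv.Perm.sign τ = ∏ i, Equiv.Perm.sign (ε i) := by
      rw [hτ, Equiv.Perm.sign_mul, Equiv.Perm.sign_prodCongrLeft, Equiv.Perm.sign_prodCongrRight]
      simp
    simp only [hprod, hs]
    push_cast
    rw [← Finset.prod_mul_distrib]
    refine Finset.prod_eq_one fun i _ => ?_
    rcases Int.units_eq_one_or (Equiv.Perm.sign (ε i)) with h | h <;> simp [h]
  · push Not at h
    obtain ⟨i, hi⟩ := h
    rw [Finset.prod_eq_zero (Finset.mem_univ i) (if_neg hi), mul_zero]

/-- All terms are `0` or `1` and the identity contributes `1`, so no cancellation can occur. -/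
theorem pfaffian_standardSkew_ne_zero (hm : Even m) : pfaffian (standardSkew hm) ≠ 0 := by
  rw [pfaffian_eq hm]
  have hterm : ∀ σ : Equiv.Perm (Fin m), ((Equiv.Perm.sign σ : ℤ) : ℂ) *
      ∏ k, standardSkew hm (σ (pairEquiv hm (k, 0))) (σ (pairEquiv hm (k, 1))) =
      if ∀ i, ((pairEquiv hm).symm (σ (pairEquiv hm (i, 0)))).1 =
        ((pairEquiv hm).symm (σ (pairEquiv hm (i, 1)))).1 then 1 else 0 := by
    intro σ
    have h := standardSkew_term (((pairEquiv hm).trans σ).trans (pairEquiv hm).symm)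
    have hs : Equiv.Perm.sign (((pairEquiv hm).trans σ).trans (pairEquiv hm).symm) =
        Equiv.Perm.sign σ := Equiv.Perm.sign_symm_trans_trans σ (pairEquiv hm).symm
    rw [hs] at h
    exact h
  rw [Finset.sum_congr rfl fun σ _ => hterm σ, ← Finset.sum_filter, Finset.sum_const,
    nsmul_eq_mul, mul_one]
  refine mul_ne_zero (inv_ne_zero (mul_ne_zero (pow_ne_zero _ two_ne_zero)
    (Nat.cast_ne_zero.2 (Nat.factorial_ne_zero _)))) (Nat.cast_ne_zero.2 ?_)
  refine Finset.card_ne_zero_of_mem (a := 1) ?_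
  simp

open Filter Topology in
/-- An entire function `p` with `q p' = h p`, `q(0) ≠ 0` and `p(0) = 0` vanishes. -/
theorem eq_zero_of_mul_deriv_eq {p p' q h : ℂ → ℂ} (hp : ∀ t, HasDerivAt p (p' t) t)
    (hq : Continuous q) (hh : Continuous h) (hq0 : q 0 ≠ 0) (hp0 : p 0 = 0)
    (heq : ∀ t, q t * p' t = h t * p t) (t : ℂ) : p t = 0 := by
  have hd : Differentiable ℂ p := fun t => (hp t).differentiableAt
  have han : AnalyticOnNhd ℂ p Set.univ := fun z _ => hd.analyticAt z
  have hev : ∀ᶠ z in 𝓝 (0 : ℂ), p z = 0 := by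
    by_contra hne
    obtain ⟨k, g, hg, hg0, hpg⟩ := ((hd.analyticAt 0).exists_eventuallyEq_pow_smul_nonzero_iff).2 hne
    have hk : k ≠ 0 := by
      rintro rfl
      have := hpg.self_of_nhds
      rw [hp0] at this
      simp at this
      exact hg0 this.symm
    have hpg' : p =ᶠ[𝓝 0] fun z => z ^ k * g z := by
      filter_upwards [hpg] with z hz
      rw [hz, sub_zero, smul_eq_mul]
    have hgd : ∀ᶠ z in 𝓝 (0 : ℂ), DifferentiableAt ℂ g z :=
      hg.eventually_analyticAt.mono fun z hz => hz.differentiableAt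
    -- Write `p = z ^ k * g` with `g 0 ≠ 0` and `k ≥ 1`. After division by `z ^ (k - 1)` the limit
    -- `z → 0` gives `q 0 * k * g 0 = 0`, a contradiction.
    have key : ∀ᶠ z in 𝓝[≠] (0 : ℂ),
        q z * (k * g z + z * deriv g z) = z * (h z * g z) := by
      have h1 := (hpg'.eventually_nhds.and hgd).filter_mono (nhdsWithin_le_nhds (s := {0}ᶜ))
      filter_upwards [h1, self_mem_nhdsWithin] with z ⟨hz, hzd⟩ hz0
      have hz0 : z ≠ 0 := hz0
      have e1 : p' z = k * z ^ (k - 1) * g z + z ^ k * deriv g z :=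
        (hp z).unique ((((hasDerivAt_pow k z).mul hzd.hasDerivAt)).congr_of_eventuallyEq hz)
      have e2 := heq z
      rw [e1, hz.self_of_nhds] at e2
      obtain ⟨k, rfl⟩ := Nat.exists_eq_succ_of_ne_zero hk
      simp only [Nat.succ_eq_add_one, Nat.add_sub_cancel] at e2
      refine mul_left_cancel₀ (pow_ne_zero k hz0) ?_
      rw [pow_succ] at e2
      push_cast at e2 ⊢
      linear_combination e2
    have hgc : ContinuousAt g 0 := hg.continuousAt
    have hgc' : ContinuousAt (deriv g) 0 := hg.deriv.continuousAt
    have c1 : Tendsto (fun z => q z * (k * g z + z * deriv g z)) (𝓝[≠] 0)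
        (𝓝 (q 0 * (k * g 0 + 0 * deriv g 0))) := by
      refine Tendsto.mono_left ?_ nhdsWithin_le_nhds
      exact hq.continuousAt.mul ((continuousAt_const.mul hgc).add (continuousAt_id.mul hgc'))
    have c2 : Tendsto (fun z => z * (h z * g z)) (𝓝[≠] 0) (𝓝 (0 * (h 0 * g 0))) := by
      refine Tendsto.mono_left ?_ nhdsWithin_le_nhds
      exact continuousAt_id.mul (hh.continuousAt.mul hgc)
    have := tendsto_nhds_unique (c1.congr' key) c2
    simp [hq0, hg0, hk] at this
  exact han.eqOn_zero_of_preconnected_of_eventuallyEq_zero isPreconnected_univ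
    (Set.mem_univ 0) hev (Set.mem_univ t)

/-- On the line from `A` to the standard skew matrix, `M = A + t z` satisfies `det M · (Pf M)' = ½
tr (z adj M) · Pf M`. If the Pfaffian vanished at `A`, where the determinant does not, it would
vanish on the whole line by analyticity, hence at the standard matrix. -/
theorem pfaffian_ne_zero (hm : Even m) {A : Matrix (Fin m) (Fin m) ℂ} (hA : Aᵀ = -A)
    (hdet : A.det ≠ 0) : pfaffian A ≠ 0 := by
  intro h0
  refine pfaffian_standardSkew_ne_zero hm ?_
  set z := standardSkew hm - A with hz
  have hzt : zᵀ = -z := by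
    rw [hz, Matrix.transpose_sub, transpose_standardSkew, hA]; abel
  have hcurve : ∀ t : ℂ, HasDerivAt (fun t : ℂ => A + t • z) z t := fun t =>
    (((hasDerivAt_id t).smul_const z).const_add A).congr_deriv (by simp)
  have hpf : ∀ t : ℂ, HasDerivAt (fun t : ℂ => pfaffian (A + t • z))
      (fderiv ℂ pfaffian (A + t • z) z) t := fun t => by
    have h := (hasFDerivAt_pfaffian (A + t • z)).comp_hasDerivAt t (hcurve t)
    exact h
  have hcont : Continuous fun t : ℂ => A + t • z := by fun_prop
  have hh : Continuous fun t : ℂ => ((1 / 2 : ℂ) • (z * (A + t • z).adjugate)).trace := by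
    have h1 : Continuous fun t : ℂ => z * (A + t • z).adjugate :=
      continuous_const.matrix_mul hcont.matrix_adjugate
    exact (h1.const_smul (1 / 2 : ℂ)).matrix_trace
  have h := eq_zero_of_mul_deriv_eq (p := fun t : ℂ => pfaffian (A + t • z))
    (p' := fun t => fderiv ℂ pfaffian (A + t • z) z)
    (q := fun t => (A + t • z).det) (h := fun t => ((1 / 2 : ℂ) • (z * (A + t • z).adjugate)).trace)
    hpf
    hcont.matrix_det
    hh
    (by simpa using hdet) (by simpa using h0) ?_ 1
  · simpa [hz] using h
  · intro t
    have hM : (A + t • z)ᵀ = -(A + t • z) := by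
      rw [Matrix.transpose_add, Matrix.transpose_smul, hA, hzt, smul_neg]; abel
    -- The choice `a = ½ z adj M` gives `a M + M aᵀ = det M • z`, once `adj M` is known to be skew;
    -- this holds because the size is even and `adj` has degree `m - 1`.
    rw [← fderiv_pfaffian_infinitesimal hm, ← smul_eq_mul, ← map_smul]
    congr 1
    generalize A + t • z = M at hM
    have hadj : (M.adjugate)ᵀ = -M.adjugate := by
      rw [Matrix.adjugate_transpose, hM, ← neg_one_smul ℂ M, Matrix.adjugate_smul]
      rcases Nat.eq_zero_or_pos m with rfl | hpos
      · ext i; exact i.elim0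
      · rw [Fintype.card_fin, Odd.neg_one_pow, neg_one_smul]
        exact Nat.Even.sub_odd hpos hm odd_one
    rw [Matrix.transpose_smul, Matrix.transpose_mul, hadj, hzt, Matrix.smul_mul, Matrix.mul_smul,
      Matrix.mul_assoc, Matrix.adjugate_mul, neg_mul_neg, ← Matrix.mul_assoc,
      Matrix.mul_adjugate, Matrix.mul_smul, Matrix.smul_mul, Matrix.mul_one, Matrix.one_mul,
      ← add_smul]
    norm_num

end PfaffianGradient

/-! ### Eigenspaces, minimal polynomials and separating vectors of endomorphisms. -/

section LinearAlgebra

open Module Polynomial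

attribute [-instance] LieRing.ofAssociativeRing

/-- The map `g` sends `ker (f g)` into `ker f ⊓ range g`, with kernel inside `ker g`. -/
theorem finrank_ker_comp_le_inf {V : Type*} [AddCommGroup V] [Module ℂ V] [FiniteDimensional ℂ V]
    (f g : End ℂ V) :
    finrank ℂ (LinearMap.ker (f * g)) ≤
      finrank ℂ (LinearMap.ker f ⊓ LinearMap.range g : Submodule ℂ V) +
        finrank ℂ (LinearMap.ker g) := by
  let h : LinearMap.ker (f * g) →ₗ[ℂ] (LinearMap.ker f ⊓ LinearMap.range g : Submodule ℂ V) :=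
    g.restrict fun x hx => ⟨by simpa using hx, LinearMap.mem_range_self g x⟩
  have h1 := LinearMap.finrank_range_add_finrank_ker h
  have h2 : finrank ℂ (LinearMap.range h) ≤
    finrank ℂ (LinearMap.ker f ⊓ LinearMap.range g : Submodule ℂ V) := Submodule.finrank_le _
  have h3 : finrank ℂ (LinearMap.ker h) ≤ finrank ℂ (LinearMap.ker g) := by
    let i : LinearMap.ker h →ₗ[ℂ] LinearMap.ker g :=
      ((LinearMap.ker (f * g)).subtype.comp (LinearMap.ker h).subtype).codRestrict _
        fun x => congr_arg Subtype.val x.2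
    refine LinearMap.finrank_le_finrank_of_injective (f := i) fun x y hxy => ?_
    have hval : (i x : V) = i y := by rw [hxy]
    exact Subtype.ext (Subtype.ext hval)
  omega

theorem finrank_ker_comp_le {V : Type*} [AddCommGroup V] [Module ℂ V] [FiniteDimensional ℂ V]
    (f g : End ℂ V) :
    finrank ℂ (LinearMap.ker (f * g)) ≤
      finrank ℂ (LinearMap.ker f) + finrank ℂ (LinearMap.ker g) :=
  (finrank_ker_comp_le_inf f g).trans
    (Nat.add_le_add_right (Submodule.finrank_mono inf_le_left) _)

/-- If `f` has eigenspaces of dimension at most one at the roots of `p`, the kernel of `p(f)` has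
dimension at most the degree of `p`. -/
theorem finrank_ker_aeval_le {V : Type*} [AddCommGroup V] [Module ℂ V] [FiniteDimensional ℂ V]
    (f : End ℂ V) (p : ℂ[X]) (hp : p ≠ 0)
    (h : ∀ μ, p.IsRoot μ → finrank ℂ (LinearMap.ker (f - algebraMap ℂ _ μ)) ≤ 1) :
    finrank ℂ (LinearMap.ker (aeval f p)) ≤ p.natDegree := by
  induction hd : p.natDegree generalizing p with
  | zero =>
    rw [eq_C_of_natDegree_eq_zero hd] at hp ⊢
    have hc : p.coeff 0 ≠ 0 := fun h0 => hp (by rw [h0, C_0])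
    rw [aeval_C, Nat.le_zero, Submodule.finrank_eq_zero, LinearMap.ker_eq_bot']
    intro x hx
    rw [Module.algebraMap_end_apply] at hx
    exact (smul_eq_zero.1 hx).resolve_left hc
  | succ d ih =>
    obtain ⟨μ, hμ⟩ := IsAlgClosed.exists_root p (by
      rw [degree_eq_natDegree hp, hd]; exact_mod_cast Nat.succ_ne_zero d)
    obtain ⟨q, rfl⟩ := dvd_iff_isRoot.2 hμ
    have hq : q ≠ 0 := right_ne_zero_of_mul hp
    rw [natDegree_mul (X_sub_C_ne_zero μ) hq, natDegree_X_sub_C] at hd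
    have h1 := ih q hq (fun ν hν => h ν (hν.dvd (Dvd.intro_left _ rfl))) (by omega)
    have h2 := finrank_ker_comp_le (aeval f (X - C μ)) (aeval f q)
    rw [map_mul]
    have h3 := h μ hμ
    rw [map_sub, aeval_X, aeval_C] at h2 ⊢
    omega

/-- A lower bound for the degree of the minimal polynomial of an endomorphism all of whose
eigenspaces are lines, up to an exceptional eigenvalue `0`. -/
theorem finrank_le_natDegree_minpoly_add {V : Type*} [AddCommGroup V] [Module ℂ V]
    [FiniteDimensional ℂ V] (f : End ℂ V) (e : ℕ)
    (h : ∀ μ, μ ≠ 0 → finrank ℂ (LinearMap.ker (f - algebraMap ℂ _ μ)) ≤ 1)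
    (h0 : ∀ k, finrank ℂ (LinearMap.ker (f ^ k)) ≤ k + e) :
    finrank ℂ V ≤ (minpoly ℂ f).natDegree + e := by
  have hm : minpoly ℂ f ≠ 0 := minpoly.ne_zero (Algebra.IsIntegral.isIntegral (R := ℂ) f)
  -- Splitting off the eigenvalue `0`: the minimal polynomial is `X ^ k * q` with `q(0) ≠ 0`. Then
  -- `ker q(f)` is bounded by `deg q`, and `ker f ^ k` by the hypothesis `h0`.
  obtain ⟨q, hq, hndvd⟩ :=
    Polynomial.exists_eq_pow_rootMultiplicity_mul_and_not_dvd (minpoly ℂ f) hm (0 : ℂ)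
  set k := rootMultiplicity 0 (minpoly ℂ f)
  rw [C_0, sub_zero] at hq hndvd
  have hq0 : q ≠ 0 := by rintro rfl; exact hm (by rw [hq, mul_zero])
  have hroot : ¬ q.IsRoot 0 := fun hr => hndvd (X_dvd_iff.2 (by rwa [coeff_zero_eq_eval_zero]))
  have h1 := finrank_ker_aeval_le f q hq0 fun μ hμ => h μ (by rintro rfl; exact hroot hμ)
  have h2 := finrank_ker_comp_le (aeval f (X ^ k : ℂ[X])) (aeval f q)
  rw [← map_mul, ← hq, minpoly.aeval, LinearMap.ker_zero, finrank_top, map_pow, aeval_X] at h2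
  have h3 := h0 k
  rw [hq, natDegree_mul (pow_ne_zero _ X_ne_zero) hq0, natDegree_X_pow]
  omega

/-- A version of the cyclic vector theorem: some vector has the same annihilator in `ℂ[X]` as
the whole space. -/
theorem exists_separating_vector {V : Type*} [AddCommGroup V] [Module ℂ V]
    [FiniteDimensional ℂ V] (f : End ℂ V) :
    ∃ v : V, ∀ p : ℂ[X], aeval f p v = 0 → aeval f p = 0 := by
  obtain ⟨x, hx⟩ := exists_ker_toSpanSingleton_eq_annihilator ℂ[X] (AEval' f)
  obtain ⟨v, rfl⟩ := (AEval'.of f).surjective x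
  refine ⟨v, fun p hp => ?_⟩
  have h1 : p ∈ LinearMap.ker (LinearMap.toSpanSingleton ℂ[X] (AEval' f) (AEval'.of f v)) := by
    rw [LinearMap.mem_ker, LinearMap.toSpanSingleton_apply]
    have := AEval.of_aeval_smul (R := ℂ) (M := V) f p v
    rw [Module.End.smul_def, hp, map_zero] at this
    exact this.symm
  rw [hx, AEval.annihilator_eq_ker_aeval] at h1
  exact h1

end LinearAlgebra

/-! ### Orthogonality, and parity of the rank of skew matrices. -/

section MatrixLinearAlgebra

open Module Polynomial

variable {n : ℕ}

theorem finrank_ker_add_rank {m : ℕ} (A : Matrix (Fin m) (Fin n) ℂ) :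
    finrank ℂ (LinearMap.ker A.mulVecLin) + A.rank = n := by
  rw [add_comm, Matrix.rank, LinearMap.finrank_range_add_finrank_ker]
  simp

theorem finrank_perp {ι : Type*} [Fintype ι] {v : ι → Fin n → ℂ} (hv : LinearIndependent ℂ v) :
    finrank ℂ (LinearMap.ker (Matrix.of v).mulVecLin) + Fintype.card ι = n := by
  have h : (Matrix.of v).rank = Fintype.card ι := LinearIndependent.rank_matrix (M := Matrix.of v) hv
  rw [← h, add_comm, Matrix.rank, LinearMap.finrank_range_add_finrank_ker]
  simp

theorem exists_dotProduct_eq {ι : Type*} [Fintype ι] {v : ι → Fin n → ℂ}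
    (hv : LinearIndependent ℂ v) (c : ι → ℂ) : ∃ p, ∀ i, v i ⬝ᵥ p = c i := by
  have h : (Matrix.of v).rank = Fintype.card ι := LinearIndependent.rank_matrix (M := Matrix.of v) hv
  have h2 : LinearMap.range (Matrix.of v).mulVecLin = ⊤ :=
    Submodule.eq_top_of_finrank_eq (by rw [← Matrix.rank, h, finrank_fintype_fun_eq_card])
  obtain ⟨p, hp⟩ := LinearMap.range_eq_top.1 h2 c
  exact ⟨p, fun i => congr_fun hp i⟩

theorem dotProduct_mulVec_skew {A : Matrix (Fin n) (Fin n) ℂ} (hA : Aᵀ = -A) (a b : Fin n → ℂ) :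
    a ⬝ᵥ A *ᵥ b = -(A *ᵥ a ⬝ᵥ b) := by
  rw [Matrix.dotProduct_mulVec, ← Matrix.mulVec_transpose, hA, Matrix.neg_mulVec, neg_dotProduct]

theorem dotProduct_mulVec_skew_self {A : Matrix (Fin n) (Fin n) ℂ} (hA : Aᵀ = -A)
    (a : Fin n → ℂ) : a ⬝ᵥ A *ᵥ a = 0 := by
  have h := dotProduct_mulVec_skew hA a a
  rw [dotProduct_comm (A *ᵥ a)] at h
  linear_combination h / 2

theorem even_of_skew_of_det_ne_zero {ι : Type*} [Fintype ι] [DecidableEq ι] {A : Matrix ι ι ℂ}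
    (hA : Aᵀ = -A) (h : A.det ≠ 0) : Even (Fintype.card ι) := by
  by_contra hodd
  rw [Nat.not_even_iff_odd] at hodd
  have h1 := Matrix.det_transpose A
  rw [hA, Matrix.det_neg, hodd.neg_one_pow] at h1
  exact h (by linear_combination (-1 / 2 : ℂ) * h1)

/-- On a complement of the kernel the skew form is non-degenerate. Its Gram matrix `Bᵀ A B` is an
invertible skew matrix whose size is the rank. -/
theorem even_rank_of_skew {A : Matrix (Fin n) (Fin n) ℂ} (hA : Aᵀ = -A) : Even A.rank := by
  obtain ⟨U, hU⟩ := Submodule.exists_isCompl (LinearMap.ker A.mulVecLin)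
  have hfin : finrank ℂ U = A.rank := by
    have h1 := Submodule.finrank_add_eq_of_isCompl hU
    have h2 := finrank_ker_add_rank A
    rw [finrank_fin_fun] at h1
    omega
  let b := Module.finBasisOfFinrankEq ℂ U hfin
  let B : Matrix (Fin n) (Fin A.rank) ℂ := Matrix.of fun i j => (b j : Fin n → ℂ) i
  have hB : ∀ v, B *ᵥ v = ((∑ j, v j • b j : U) : Fin n → ℂ) := by
    intro v
    ext i
    simp [B, Matrix.mulVec, dotProduct, mul_comm]
  have hdet : (Bᵀ * A * B).det ≠ 0 := by
    intro h0
    obtain ⟨v, hv, hv0⟩ := Matrix.exists_mulVec_eq_zero_iff.2 h0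
    set w := B *ᵥ v with hw
    have hwU : w ∈ U := by rw [hw, hB]; exact Subtype.coe_prop _
    have horth : ∀ u, u ⬝ᵥ A *ᵥ w = 0 := by
      intro u
      have hu : u ∈ LinearMap.ker A.mulVecLin ⊔ U := by rw [hU.sup_eq_top]; trivial
      obtain ⟨k, hk, u', hu', rfl⟩ := Submodule.mem_sup.1 hu
      have hk' : A *ᵥ k = 0 := hk
      rw [add_dotProduct, dotProduct_mulVec_skew hA k, hk', zero_dotProduct, neg_zero, zero_add]
      have h1 : B *ᵥ (b.repr ⟨u', hu'⟩) = u' := by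
        rw [hB, b.sum_repr]
      rw [← h1, ← Matrix.vecMul_transpose, ← Matrix.dotProduct_mulVec, Matrix.mulVec_mulVec, hw,
        Matrix.mulVec_mulVec, hv0, dotProduct_zero]
    have hAw : A *ᵥ w = 0 := dotProduct_eq_zero _ fun u => by rw [dotProduct_comm]; exact horth u
    have hw0 : w = 0 := by
      have : w ∈ LinearMap.ker A.mulVecLin ⊓ U := ⟨hAw, hwU⟩
      rwa [hU.inf_eq_bot, Submodule.mem_bot] at this
    rw [hw, hB, Submodule.coe_eq_zero] at hw0
    exact hv (funext (Fintype.linearIndependent_iff.1 b.linearIndependent v hw0))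
  have h := even_of_skew_of_det_ne_zero (A := Bᵀ * A * B)
    (by simp [Matrix.transpose_mul, hA, Matrix.mul_assoc]) hdet
  simpa using h

theorem eq_zero_of_rank_eq_zero {A : Matrix (Fin n) (Fin n) ℂ} (h : A.rank = 0) : A = 0 := by
  rw [Matrix.rank, Submodule.finrank_eq_zero, LinearMap.range_eq_bot] at h
  refine Matrix.ext_of_mulVec_single fun i => ?_
  rw [Matrix.zero_mulVec]
  exact congr_fun (congr_arg DFunLike.coe h) (Pi.single i 1)

end MatrixLinearAlgebra

/-! ### Upper bounds for centralizers, and parity of polynomials in skew matrices. -/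

section Centralizer

open Module Polynomial

variable {n : ℕ}

theorem exists_separating_mulVec (A : Matrix (Fin n) (Fin n) ℂ) :
    ∃ v : Fin n → ℂ, ∀ p : ℂ[X], aeval A p *ᵥ v = 0 → aeval A p = 0 := by
  obtain ⟨v, hv⟩ := exists_separating_vector (Matrix.toLinAlgEquiv' A)
  refine ⟨v, fun p hp => ?_⟩
  have h1 : aeval (Matrix.toLinAlgEquiv' A) p = Matrix.toLinAlgEquiv' (aeval A p) :=
    aeval_algHom_apply (Matrix.toLinAlgEquiv' : _ ≃ₐ[ℂ] _).toAlgHom A p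
  have h2 := hv p (by rw [h1]; exact hp)
  rw [h1] at h2
  exact (map_eq_zero_iff _ (Matrix.toLinAlgEquiv' : _ ≃ₐ[ℂ] _).injective).1 h2

theorem aeval_ne_zero_of_natDegree_lt {A : Matrix (Fin n) (Fin n) ℂ} {p : ℂ[X]} (hp : p ≠ 0)
    (hd : p.natDegree < (minpoly ℂ A).natDegree) : aeval A p ≠ 0 := fun h =>
  absurd (natDegree_le_of_dvd (minpoly.dvd ℂ A h) hp) (by omega)

/-- A linear relation is a polynomial of degree below `d` killing the separating vector, hence
annihilating `A`. -/
theorem exists_linearIndependent_pow_mulVec (A : Matrix (Fin n) (Fin n) ℂ) {d : ℕ}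
    (hd : d ≤ (minpoly ℂ A).natDegree) :
    ∃ v : Fin n → ℂ, LinearIndependent ℂ fun i : Fin d => A ^ (i : ℕ) *ᵥ v := by
  obtain ⟨v, hv⟩ := exists_separating_mulVec A
  refine ⟨v, Fintype.linearIndependent_iff.2 fun c hc i => ?_⟩
  set p : ℂ[X] := ∑ i : Fin d, C (c i) * X ^ (i : ℕ) with hp
  have hpc : ∀ i : Fin d, p.coeff i = c i := by
    intro i
    simp only [hp, finsetSum_coeff, coeff_C_mul_X_pow]
    rw [Finset.sum_eq_single i]
    · simp
    · intro j _ hj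
      rw [if_neg fun h => hj (Fin.ext h.symm)]
    · simp
  have hpd : p.degree < d := by
    refine (degree_sum_le _ _).trans_lt ((Finset.sup_lt_iff (WithBot.bot_lt_coe d)).2 fun j _ => ?_)
    exact (degree_C_mul_X_pow_le _ _).trans_lt (WithBot.coe_lt_coe.2 j.2)
  have hpa : aeval A p = 0 := by
    refine hv p ?_
    rw [← hc, hp, map_sum, Matrix.sum_mulVec]
    refine Finset.sum_congr rfl fun j _ => ?_
    rw [map_mul, aeval_C, map_pow, aeval_X, ← Algebra.smul_def, Matrix.smul_mulVec]
  have hp0 : p = 0 := by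
    by_contra hne
    rw [degree_eq_natDegree hne] at hpd
    have : p.natDegree < d := by exact_mod_cast hpd
    exact aeval_ne_zero_of_natDegree_lt hne (by omega) hpa
  rw [← hpc, hp0, coeff_zero]

theorem pow_mulVec_mem_ker {A Z : Matrix (Fin n) (Fin n) ℂ} (hAZ : A * Z = Z * A)
    {v : Fin n → ℂ} (hv : Z *ᵥ v = 0) (i : ℕ) : Z *ᵥ A ^ i *ᵥ v = 0 := by
  have h : Commute (A ^ i) Z := (show Commute A Z from hAZ).pow_left i
  rw [Matrix.mulVec_mulVec, ← h.eq, ← Matrix.mulVec_mulVec, hv, Matrix.mulVec_zero]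

theorem rank_add_le_of_commute {A Z : Matrix (Fin n) (Fin n) ℂ} (hAZ : A * Z = Z * A)
    {v : Fin n → ℂ} (hv : Z *ᵥ v = 0) {d : ℕ}
    (hd : LinearIndependent ℂ fun i : Fin d => A ^ (i : ℕ) *ᵥ v) : Z.rank + d ≤ n := by
  have h1 := finrank_ker_add_rank Z
  have h2 : LinearIndependent ℂ fun i : Fin d =>
      (⟨A ^ (i : ℕ) *ᵥ v, pow_mulVec_mem_ker hAZ hv i⟩ : LinearMap.ker Z.mulVecLin) :=
    LinearIndependent.of_comp (LinearMap.ker Z.mulVecLin).subtype hd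
  have h3 := h2.fintype_card_le_finrank
  rw [Fintype.card_fin] at h3
  omega

theorem eq_zero_of_skew_of_rank_le_one {Z : Matrix (Fin n) (Fin n) ℂ} (hZ : Zᵀ = -Z)
    (h : Z.rank ≤ 1) : Z = 0 := by
  refine eq_zero_of_rank_eq_zero ?_
  obtain ⟨k, hk⟩ := even_rank_of_skew hZ
  omega

/-- Moving half of the powers across the pairing gives, up to sign, the skew form of `Z` evaluated
at `(A ^ j v, A ^ j v)`. -/
theorem dotProduct_pow_mulVec_eq_zero {A Z : Matrix (Fin n) (Fin n) ℂ} (hA : Aᵀ = -A)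
    (hZ : Zᵀ = -Z) (hAZ : A * Z = Z * A) (v : Fin n → ℂ) (j : ℕ) :
    A ^ (2 * j) *ᵥ v ⬝ᵥ Z *ᵥ v = 0 := by
  have hc : Commute (A ^ j) Z := (show Commute A Z from hAZ).pow_left j
  have h1 : A ^ (2 * j) *ᵥ v ⬝ᵥ Z *ᵥ v = (-1) ^ j * (A ^ j *ᵥ v ⬝ᵥ Z *ᵥ A ^ j *ᵥ v) := by
    rw [dotProduct_comm, two_mul, pow_add, ← Matrix.mulVec_mulVec, Matrix.dotProduct_mulVec,
      ← Matrix.mulVec_transpose, Matrix.transpose_pow, hA, ← neg_one_smul ℂ A, _root_.smul_pow,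
      Matrix.smul_mulVec, smul_dotProduct, Matrix.mulVec_mulVec, hc.eq, ← Matrix.mulVec_mulVec,
      dotProduct_comm, smul_eq_mul]
  rw [h1, dotProduct_mulVec_skew_self hZ, mul_zero]

theorem mem_ker_ad {F : Family} {x z : lieAlg F n} :
    z ∈ LinearMap.ker (LieAlgebra.ad ℂ (lieAlg F n) x) ↔
      (x : Matrix (Fin n) (Fin n) ℂ) * z = (z : Matrix (Fin n) (Fin n) ℂ) * x := by
  rw [LinearMap.mem_ker, LieAlgebra.ad_apply, ← sub_eq_zero (a := (x : Matrix (Fin n) (Fin n) ℂ) * z),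
    ← coe_lie]
  exact Subtype.ext_iff

/-- Evaluation of the elements of the centralizer of `x` at a vector. -/
def evalCentralizer {F : Family} (x : lieAlg F n) (v : Fin n → ℂ) :
    LinearMap.ker (LieAlgebra.ad ℂ (lieAlg F n) x) →ₗ[ℂ] (Fin n → ℂ) where
  toFun z := (z.1 : Matrix (Fin n) (Fin n) ℂ) *ᵥ v
  map_add' _ _ := Matrix.add_mulVec _ _ _
  map_smul' _ _ := Matrix.smul_mulVec _ _ _

/-- Evaluation at a cyclic vector is injective on the centralizer. -/
theorem finrank_centralizer_gl_le {x : lieAlg .gl n}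
    (hd : n ≤ (minpoly ℂ (x : Matrix (Fin n) (Fin n) ℂ)).natDegree) :
    finrank ℂ (LinearMap.ker (LieAlgebra.ad ℂ (lieAlg .gl n) x)) ≤ n := by
  obtain ⟨v, hv⟩ := exists_linearIndependent_pow_mulVec _ hd
  have h : Function.Injective (evalCentralizer x v) := by
    refine (injective_iff_map_eq_zero _).2 fun z hz => ?_
    have h1 := rank_add_le_of_commute (mem_ker_ad.1 z.2) hz hv
    exact Subtype.ext (Subtype.ext (eq_zero_of_rank_eq_zero (by omega)))
  have := LinearMap.finrank_le_finrank_of_injective h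
  rwa [finrank_fin_fun] at this

/-- A centralizing `z` with `z v = 0` kills `d ≥ n - 1` independent vectors, so it has rank at most
one and, being skew, is zero. Hence `z ↦ z v` is injective, and its image is orthogonal to the `(d +
1) / 2` vectors `x ^ (2 j) v` with `2 j < d`. -/
theorem finrank_centralizer_so_le {x : lieAlg .so n} {d : ℕ} (hn : n ≤ d + 1)
    (hd : d ≤ (minpoly ℂ (x : Matrix (Fin n) (Fin n) ℂ)).natDegree) :
    finrank ℂ (LinearMap.ker (LieAlgebra.ad ℂ (lieAlg .so n) x)) + (d + 1) / 2 ≤ n := by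
  obtain ⟨v, hv⟩ := exists_linearIndependent_pow_mulVec _ hd
  have h : Function.Injective (evalCentralizer x v) := by
    refine (injective_iff_map_eq_zero _).2 fun z hz => ?_
    have h1 := rank_add_le_of_commute (mem_ker_ad.1 z.2) hz hv
    exact Subtype.ext (Subtype.ext (eq_zero_of_skew_of_rank_le_one (transpose_coe_so z.1)
      (by omega)))
  have hv2 : LinearIndependent ℂ fun j : Fin ((d + 1) / 2) =>
      (x : Matrix (Fin n) (Fin n) ℂ) ^ (2 * (j : ℕ)) *ᵥ v :=
    hv.comp (fun j : Fin ((d + 1) / 2) => (⟨2 * j.1, by have := j.2; omega⟩ : Fin d))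
      fun i j hij => Fin.ext (by have := congr_arg Fin.val hij; simp only at this; omega)
  have h2 := finrank_perp hv2
  rw [Fintype.card_fin] at h2
  have h3 : LinearMap.range (evalCentralizer x v) ≤ LinearMap.ker (Matrix.of fun j : Fin
      ((d + 1) / 2) => (x : Matrix (Fin n) (Fin n) ℂ) ^ (2 * (j : ℕ)) *ᵥ v).mulVecLin := by
    rintro _ ⟨z, rfl⟩
    rw [LinearMap.mem_ker]
    funext j
    exact dotProduct_pow_mulVec_eq_zero (transpose_coe_so x) (transpose_coe_so z.1)
      (mem_ker_ad.1 z.2) v j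
  have h4 := Submodule.finrank_mono h3
  rw [LinearMap.finrank_range_of_inj h] at h4
  omega

theorem transpose_aeval {A : Matrix (Fin n) (Fin n) ℂ} (hA : Aᵀ = -A) (p : ℂ[X]) :
    (aeval A p)ᵀ = aeval A (p.comp (-X)) := by
  rw [aeval_comp, map_neg, aeval_X, ← hA, aeval_eq_sum_range, aeval_eq_sum_range,
    Matrix.transpose_sum]
  simp only [Matrix.transpose_smul, Matrix.transpose_pow]

/-- Since `Aᵀ = -A`, the polynomial `m(-X)` also annihilates `A`. After correcting the sign it is
monic of the same degree, so it equals `m`. -/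
theorem minpoly_comp_neg_X {A : Matrix (Fin n) (Fin n) ℂ} (hA : Aᵀ = -A) :
    (minpoly ℂ A).comp (-X) = (-1) ^ (minpoly ℂ A).natDegree * minpoly ℂ A := by
  set m := minpoly ℂ A
  have hm : m.Monic := minpoly.monic (Algebra.IsIntegral.isIntegral (R := ℂ) A)
  have h1 := hm.neg_one_pow_natDegree_mul_comp_neg_X
  have h2 : aeval A ((-1) ^ m.natDegree * m.comp (-X)) = 0 := by
    rw [map_mul, ← transpose_aeval hA, minpoly.aeval, Matrix.transpose_zero, mul_zero]
  have h3 : m ∣ (-1) ^ m.natDegree * m.comp (-X) := minpoly.dvd ℂ A h2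
  have h4 : (-1) ^ m.natDegree * m.comp (-X) = m := by
    refine (eq_of_monic_of_dvd_of_natDegree_le hm h1 h3 ?_)
    refine natDegree_mul_le.trans ?_
    rw [natDegree_comp, natDegree_neg, natDegree_X, mul_one]
    have : ((-1 : ℂ[X]) ^ m.natDegree).natDegree = 0 := by
      rw [← C_1, ← C_neg, ← C_pow, natDegree_C]
    omega
  calc m.comp (-X) = (-1) ^ m.natDegree * ((-1) ^ m.natDegree * m.comp (-X)) := by
        rw [← mul_assoc, ← mul_pow]; simp
    _ = (-1) ^ m.natDegree * m := by rw [h4]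

/-- Odd polynomials. -/
def IsOddPoly (p : ℂ[X]) : Prop := p.comp (-X) = -p

theorem IsOddPoly.transpose_aeval {p : ℂ[X]} (hp : IsOddPoly p) {A : Matrix (Fin n) (Fin n) ℂ}
    (hA : Aᵀ = -A) : (aeval A p)ᵀ = -aeval A p := by
  rw [GelfandZeitlin.transpose_aeval hA, hp, map_neg]

theorem IsOddPoly.C_mul {p : ℂ[X]} (hp : IsOddPoly p) (c : ℂ) : IsOddPoly (C c * p) := by
  rw [IsOddPoly] at hp ⊢
  rw [mul_comp, C_comp, hp, mul_neg]

theorem isOddPoly_X_mul {p : ℂ[X]} (hp : p.comp (-X) = p) : IsOddPoly (X * p) := by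
  rw [IsOddPoly, mul_comp, X_comp, hp, neg_mul]

theorem isOddPoly_of_X_mul {p : ℂ[X]} (hp : (X * p).comp (-X) = X * p) : IsOddPoly p := by
  rw [mul_comp, X_comp, neg_mul, ← mul_neg] at hp
  exact neg_eq_iff_eq_neg.1 (mul_left_cancel₀ X_ne_zero hp)

theorem IsOddPoly.coeff_even {p : ℂ[X]} (hp : IsOddPoly p) (j : ℕ) : p.coeff (2 * j) = 0 := by
  have h := congr_arg (fun q : ℂ[X] => q.coeff (2 * j)) hp
  have h1 : (p.comp (-X)).coeff (2 * j) = p.coeff (2 * j) := by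
    rw [← neg_one_mul (X : ℂ[X]), ← C_1, ← C_neg, comp_C_mul_X_coeff, pow_mul]
    simp
  simp only [h1, coeff_neg] at h
  linear_combination h / 2

theorem IsOddPoly.eq_sum {p : ℂ[X]} (hp : IsOddPoly p) {s : ℕ} (hs : p.natDegree < 2 * s + 1) :
    p = ∑ j ∈ Finset.range s, C (p.coeff (2 * j + 1)) * X ^ (2 * j + 1) := by
  have h1 := as_sum_range' p (2 * s + 1) hs
  have h2 : ∀ s : ℕ, ∑ i ∈ Finset.range (2 * s + 1), monomial i (p.coeff i) =
      ∑ j ∈ Finset.range s, C (p.coeff (2 * j + 1)) * X ^ (2 * j + 1) := by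
    intro s
    induction s with
    | zero => simpa using hp.coeff_even 0
    | succ s ih =>
      rw [show 2 * (s + 1) + 1 = 2 * s + 1 + 1 + 1 by ring, Finset.sum_range_succ,
        Finset.sum_range_succ, ih, Finset.sum_range_succ, C_mul_X_pow_eq_monomial,
        show 2 * s + 1 + 1 = 2 * (s + 1) by ring, hp.coeff_even, monomial_zero_right, add_zero]
  rw [h2] at h1
  exact h1

end Centralizer

/-! ### From independent gradients to the degree of the minimal polynomial of a skew matrix. -/

section MinpolyDegree

open Module Polynomial

variable {n : ℕ}

theorem minpoly_ne_zero (A : Matrix (Fin n) (Fin n) ℂ) : minpoly ℂ A ≠ 0 :=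
  minpoly.ne_zero (Algebra.IsIntegral.isIntegral (R := ℂ) A)

theorem isOddPoly_minpoly {A : Matrix (Fin n) (Fin n) ℂ} (hA : Aᵀ = -A)
    (hd : Odd (minpoly ℂ A).natDegree) : IsOddPoly (minpoly ℂ A) := by
  rw [IsOddPoly, minpoly_comp_neg_X hA, hd.neg_one_pow, neg_one_mul]

theorem minpoly_comp_neg_X_of_even {A : Matrix (Fin n) (Fin n) ℂ} (hA : Aᵀ = -A)
    (hd : Even (minpoly ℂ A).natDegree) : (minpoly ℂ A).comp (-X) = minpoly ℂ A := by
  rw [minpoly_comp_neg_X hA, hd.neg_one_pow, one_mul]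

/-- Of the independent vectors `A ^ i v`, all but the first lie in the range of `A`. -/
theorem natDegree_minpoly_le_rank_add_one (A : Matrix (Fin n) (Fin n) ℂ) :
    (minpoly ℂ A).natDegree ≤ A.rank + 1 := by
  obtain ⟨v, hv⟩ := exists_linearIndependent_pow_mulVec A le_rfl
  set d := (minpoly ℂ A).natDegree
  have h1 : LinearIndependent ℂ fun i : Fin (d - 1) => A ^ ((i : ℕ) + 1) *ᵥ v :=
    hv.comp (fun i : Fin (d - 1) => (⟨i.1 + 1, by have := i.2; omega⟩ : Fin d))
      fun i j hij => Fin.ext (by have := congr_arg Fin.val hij; simp only at this; omega)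
  have h2 : LinearIndependent ℂ fun i : Fin (d - 1) =>
      (⟨A ^ ((i : ℕ) + 1) *ᵥ v, A ^ (i : ℕ) *ᵥ v, by
        rw [Matrix.mulVecLin_apply, Matrix.mulVec_mulVec, pow_succ']⟩ :
        LinearMap.range A.mulVecLin) :=
    LinearIndependent.of_comp (LinearMap.range A.mulVecLin).subtype h1
  have h3 := h2.fintype_card_le_finrank
  rw [Fintype.card_fin] at h3
  rw [Matrix.rank]
  omega

theorem rank_add_rank_le {A B : Matrix (Fin n) (Fin n) ℂ} (h : A * B = 0) :
    A.rank + B.rank ≤ n := by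
  simpa using Matrix.rank_add_rank_le_card_of_mul_eq_zero h

theorem two_le_rank_of_skew {Z : Matrix (Fin n) (Fin n) ℂ} (hZ : Zᵀ = -Z) (h : Z ≠ 0) :
    2 ≤ Z.rank := by
  by_contra hlt
  exact h (eq_zero_of_skew_of_rank_le_one hZ (by omega))

theorem X_dvd_minpoly_of_det_eq_zero {A : Matrix (Fin n) (Fin n) ℂ} (h : A.det = 0) :
    X ∣ minpoly ℂ A := by
  obtain ⟨v, hv, hv0⟩ := Matrix.exists_mulVec_eq_zero_iff.2 h
  rw [X_dvd_iff, coeff_zero_eq_eval_zero]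
  have h1 : Module.End.HasEigenvalue (Matrix.toLin' A) 0 :=
    Module.End.hasEigenvalue_of_hasEigenvector (x := v)
      ⟨by rw [Module.End.mem_eigenspace_iff, Matrix.toLin'_apply, hv0, zero_smul], hv⟩
  have h2 := Module.End.isRoot_of_hasEigenvalue h1
  rwa [Matrix.minpoly_toLin'] at h2

/-- Suppose `deg m < n`. Then `m` is not odd, and `X m` is too small an odd annihilator unless `deg
m = n - 1`. In that remaining case `m = X q`, where `q(A)` is a non-zero skew matrix with `A q(A) =
0`. Thus `rank A ≤ n - 2`, while `deg m ≤ rank A + 1` gives the reverse inequality, so the even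
number `rank A` would equal the odd number `n - 2`. -/
theorem le_natDegree_minpoly_of_odd (hn : Odd n) {A : Matrix (Fin n) (Fin n) ℂ} (hA : Aᵀ = -A)
    (hind : ∀ p : ℂ[X], IsOddPoly p → p.natDegree < n → aeval A p = 0 → p = 0) :
    n ≤ (minpoly ℂ A).natDegree := by
  by_contra hlt
  have hm := minpoly_ne_zero A
  set m := minpoly ℂ A with hmdef
  have hma : aeval A m = 0 := minpoly.aeval ℂ A
  have hev : Even m.natDegree := by
    by_contra hodd
    exact hm (hind m (isOddPoly_minpoly hA (Nat.not_even_iff_odd.1 hodd)) (by omega) hma)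
  have hme := minpoly_comp_neg_X_of_even hA hev
  have hd : m.natDegree + 1 = n := by
    by_contra hne
    have h := hind (X * m) (isOddPoly_X_mul hme) (by rw [natDegree_X_mul hm]; omega)
      (by rw [map_mul, hma, mul_zero])
    exact hm ((mul_eq_zero.1 h).resolve_left X_ne_zero)
  have hdet : A.det = 0 := by
    by_contra h
    have := even_of_skew_of_det_ne_zero hA h
    rw [Fintype.card_fin] at this
    exact (Nat.not_even_iff_odd.2 hn) this
  obtain ⟨q, hq⟩ := X_dvd_minpoly_of_det_eq_zero hdet
  rw [← hmdef] at hq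
  have hq0 : q ≠ 0 := by rintro rfl; exact hm (by rw [hq, mul_zero])
  have hqodd : IsOddPoly q := isOddPoly_of_X_mul (by rw [← hq, hme])
  have hqd : q.natDegree + 1 = m.natDegree := by rw [hq, natDegree_X_mul hq0]
  have hR := aeval_ne_zero_of_natDegree_lt (A := A) hq0 (by rw [← hmdef]; omega)
  have hAR : A * aeval A q = 0 := by
    rw [hq, map_mul, aeval_X] at hma
    exact hma
  have h1 := rank_add_rank_le hAR
  have h2 := two_le_rank_of_skew (hqodd.transpose_aeval hA) hR
  have h3 := natDegree_minpoly_le_rank_add_one A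
  rw [← hmdef] at h3
  obtain ⟨k, hk⟩ := even_rank_of_skew hA
  obtain ⟨l, hl⟩ := hn
  omega

/-- Skew-symmetric matrices supported on the kernel of a matrix of corank two are proportional. -/
theorem exists_eq_smul_of_skew {A G R : Matrix (Fin n) (Fin n) ℂ} (hA : Aᵀ = -A) (hG : Gᵀ = -G)
    (hR : Rᵀ = -R) (hrank : n ≤ A.rank + 2) (hAG : A * G = 0) (hAR : A * R = 0) (hG0 : G ≠ 0) :
    ∃ α : ℂ, R = α • G := by
  obtain ⟨a, b, hab⟩ : ∃ a b, G b a ≠ 0 := by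
    by_contra h
    push Not at h
    exact hG0 (Matrix.ext fun b a => h a b)
  have hRA : R * A = 0 := by
    have := congr_arg Matrix.transpose hAR
    simpa [Matrix.transpose_mul, hA, hR] using this
  have hGA : G * A = 0 := by
    have := congr_arg Matrix.transpose hAG
    simpa [Matrix.transpose_mul, hA, hG] using this
  have hker : ∀ {Z : Matrix (Fin n) (Fin n) ℂ}, A * Z = 0 → ∀ i, A *ᵥ Z.col i = 0 := by
    intro Z hZ i
    have := congr_arg (fun M : Matrix (Fin n) (Fin n) ℂ => M.col i) hZ
    exact this
  have hGa : G.col a a = 0 := by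
    have := congr_fun (congr_fun hG a) a
    simp only [Matrix.transpose_apply, Matrix.neg_apply] at this
    simp only [Matrix.col_apply]
    linear_combination this / 2
  have hRa : R.col a a = 0 := by
    have := congr_fun (congr_fun hR a) a
    simp only [Matrix.transpose_apply, Matrix.neg_apply] at this
    simp only [Matrix.col_apply]
    linear_combination this / 2
  have hGb : G.col b a ≠ 0 := by
    have := congr_fun (congr_fun hG a) b
    simp only [Matrix.transpose_apply, Matrix.neg_apply] at this
    simp only [Matrix.col_apply]
    intro h0
    exact hab (by rw [this, h0, neg_zero])
  have hGa0 : G.col a ≠ 0 := fun h => hab (congr_fun h b)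
  -- In the kernel of `A`, of dimension at most two, the vectors with vanishing `a`-th coordinate
  -- form a line: column `b` of `G` is not among them. The line contains column `a` of both `G` and
  -- `R`, whose diagonal entries vanish.
  obtain ⟨α, hα⟩ : ∃ α : ℂ, R.col a = α • G.col a := by
    let φ : LinearMap.ker A.mulVecLin →ₗ[ℂ] ℂ :=
      (LinearMap.proj a).comp (LinearMap.ker A.mulVecLin).subtype
    have h1 := LinearMap.finrank_range_add_finrank_ker φ
    have h2 : 1 ≤ finrank ℂ (LinearMap.range φ) := by
      rw [Nat.one_le_iff_ne_zero, Ne, Submodule.finrank_eq_zero, LinearMap.range_eq_bot]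
      intro h0
      exact hGb (LinearMap.congr_fun h0 ⟨G.col b, hker hAG b⟩)
    have h3 := finrank_ker_add_rank A
    let g : LinearMap.ker φ := ⟨⟨G.col a, hker hAG a⟩, hGa⟩
    have hg : g ≠ 0 := fun h => hGa0 (congr_arg (fun x => (x.1.1 : Fin n → ℂ)) h)
    have h4 : 0 < finrank ℂ (LinearMap.ker φ) := by
      have : Nontrivial (LinearMap.ker φ) := ⟨⟨g, 0, hg⟩⟩
      exact finrank_pos (R := ℂ) (M := LinearMap.ker φ)
    have h5 : finrank ℂ (LinearMap.ker φ) = 1 := by omega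
    obtain ⟨α, hα⟩ := (finrank_eq_one_iff_of_nonzero' g hg).1 h5
      ⟨⟨R.col a, hker hAR a⟩, hRa⟩
    exact ⟨α, (congr_arg (fun x => (x.1.1 : Fin n → ℂ)) hα).symm⟩
  refine ⟨α, ?_⟩
  rw [← sub_eq_zero]
  refine eq_zero_of_skew_of_rank_le_one (by simp [hR, hG]; abel) ?_
  -- The kernel of `R - α • G` contains the range of `A`, of dimension at least `n - 2`, and also
  -- the `a`-th basis vector, which is outside that range. The rank is therefore at most one, and
  -- skewness finishes.
  have hlt : LinearMap.range A.mulVecLin < LinearMap.ker (R - α • G).mulVecLin := by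
    refine lt_of_le_of_ne ?_ fun heq => ?_
    · rintro _ ⟨w, rfl⟩
      rw [LinearMap.mem_ker, Matrix.mulVecLin_apply, Matrix.mulVecLin_apply, Matrix.mulVec_mulVec,
        Matrix.sub_mul, Matrix.smul_mul, hRA, hGA, smul_zero, sub_zero, Matrix.zero_mulVec]
    · have hmem : Pi.single a 1 ∈ LinearMap.ker (R - α • G).mulVecLin := by
        rw [LinearMap.mem_ker, Matrix.mulVecLin_apply, Matrix.mulVec_single_one]
        exact sub_eq_zero.2 hα
      rw [← heq] at hmem
      obtain ⟨w, hw⟩ := hmem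
      have h1 := dotProduct_mulVec_skew hA (G.col b) w
      rw [hker hAG b, zero_dotProduct, neg_zero] at h1
      rw [Matrix.mulVecLin_apply] at hw
      rw [hw, dotProduct_single_one] at h1
      exact hGb h1
  have h1 := Submodule.finrank_lt_finrank_of_lt hlt
  have h2 := finrank_ker_add_rank (R - α • G)
  rw [← Matrix.rank] at h1
  omega

/-- As in odd size, parity leaves only `deg m = n - 2` with `m = X q + m(0)` and `q` odd.
Multiplying `m(A) = 0` by `G` gives `c q(A) + m(0) G = 0`, so independence forces `c = m(0) = 0`.
Now `q(A)` and `G` are both killed by `A`, which has corank at most two, so they are proportional,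
against independence. -/
theorem le_natDegree_minpoly_of_even (hn : Even n) {A G : Matrix (Fin n) (Fin n) ℂ}
    (hA : Aᵀ = -A) (hG : Gᵀ = -G) {c : ℂ} (hAG : A * G = c • 1)
    (hind : ∀ p : ℂ[X], IsOddPoly p → p.natDegree + 1 < n → ∀ b : ℂ, aeval A p + b • G = 0 →
      p = 0 ∧ b = 0) :
    n ≤ (minpoly ℂ A).natDegree + 1 := by
  by_contra hlt
  have hm := minpoly_ne_zero A
  set m := minpoly ℂ A with hmdef
  have hma : aeval A m = 0 := minpoly.aeval ℂ A
  have hev : Even m.natDegree := by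
    by_contra hodd
    exact hm (hind m (isOddPoly_minpoly hA (Nat.not_even_iff_odd.1 hodd)) (by omega) 0
      (by rw [hma, zero_smul, add_zero])).1
  have hme := minpoly_comp_neg_X_of_even hA hev
  have hd : m.natDegree + 2 = n := by
    by_contra hne
    have h := (hind (X * m) (isOddPoly_X_mul hme) (by rw [natDegree_X_mul hm]; omega) 0
      (by rw [map_mul, hma, mul_zero, zero_smul, add_zero])).1
    exact hm ((mul_eq_zero.1 h).resolve_left X_ne_zero)
  have hGA : G * A = c • 1 := by
    have := congr_arg Matrix.transpose hAG
    simpa [Matrix.transpose_mul, hA, hG] using this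
  have hdecomp : X * m.divX + C (m.coeff 0) = m := X_mul_divX_add m
  have hqodd : IsOddPoly m.divX := by
    refine isOddPoly_of_X_mul ?_
    have h1 : (X * m.divX + C (m.coeff 0)).comp (-X) = X * m.divX + C (m.coeff 0) := by
      rw [hdecomp]; exact hme
    rw [add_comp, C_comp] at h1
    exact add_right_cancel h1
  have hqd : m.divX.natDegree = m.natDegree - 1 := natDegree_divX_eq_natDegree_tsub_one
  have h1 : aeval A (C c * m.divX) + m.coeff 0 • G = 0 := by
    have h2 : G * aeval A m = 0 := by rw [hma, Matrix.mul_zero]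
    rw [← hdecomp, map_add, map_mul, aeval_X, aeval_C, Matrix.mul_add, ← Matrix.mul_assoc, hGA,
      Algebra.algebraMap_eq_smul_one, Matrix.mul_smul, Matrix.mul_one, Matrix.smul_mul,
      Matrix.one_mul] at h2
    rw [map_mul, aeval_C, ← Algebra.smul_def]
    exact h2
  obtain ⟨h2, h3⟩ := hind _ (hqodd.C_mul c)
    (lt_of_le_of_lt (Nat.add_le_add_right (natDegree_C_mul_le _ _) 1) (by omega)) _ h1
  have hq0 : m.divX ≠ 0 := by
    intro h0
    rw [h0, h3, C_0, mul_zero, add_zero] at hdecomp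
    exact hm hdecomp.symm
  have hc : c = 0 := C_eq_zero.1 ((mul_eq_zero.1 h2).resolve_right hq0)
  have hR := aeval_ne_zero_of_natDegree_lt (A := A) hq0 (by
    have := natDegree_X_mul hq0
    rw [h3, C_0, add_zero] at hdecomp
    rw [hdecomp] at this
    rw [← hmdef]
    omega)
  have hAR : A * aeval A m.divX = 0 := by
    rw [← hdecomp, h3, C_0, add_zero, map_mul, aeval_X] at hma
    exact hma
  have hG0 : G ≠ 0 := by
    intro h0
    have := (hind 0 (by simp [IsOddPoly]) (by simp; omega) 1 (by rw [h0]; simp)).2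
    exact one_ne_zero this
  rw [hc, zero_smul] at hAG
  have h4 := natDegree_minpoly_le_rank_add_one A
  rw [← hmdef] at h4
  obtain ⟨k, hk⟩ := even_rank_of_skew hA
  obtain ⟨l, hl⟩ := hn
  obtain ⟨α, hα⟩ := exists_eq_smul_of_skew hA hG (hqodd.transpose_aeval hA) (by omega) hAG hAR hG0
  exact hq0 (hind m.divX hqodd (by omega) (-α) (by rw [hα, neg_smul, add_neg_cancel])).1

end MinpolyDegree

/-! ### Eigenspace bounds when no centralizing element kills a given vector. -/

section Eigenspaces

open Module Polynomial

variable {n : ℕ}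

/-- The functional `v ↦ v ⬝ e` on a subspace. -/
def dotFunctional (S : Submodule ℂ (Fin n → ℂ)) (e : Fin n → ℂ) : S →ₗ[ℂ] ℂ where
  toFun v := v.1 ⬝ᵥ e
  map_add' _ _ := add_dotProduct _ _ _
  map_smul' _ _ := smul_dotProduct _ _ _

theorem finrank_le_finrank_ker_dotFunctional_add_one (S : Submodule ℂ (Fin n → ℂ))
    (e : Fin n → ℂ) : finrank ℂ S ≤ finrank ℂ (LinearMap.ker (dotFunctional S e)) + 1 := by
  have h1 := LinearMap.finrank_range_add_finrank_ker (dotFunctional S e)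
  have h2 := Submodule.finrank_le (LinearMap.range (dotFunctional S e))
  rw [finrank_self] at h2
  omega

theorem exists_mem_ne_zero_dotProduct_eq_zero (S : Submodule ℂ (Fin n → ℂ))
    (hS : 2 ≤ finrank ℂ S) (e : Fin n → ℂ) : ∃ v ∈ S, v ≠ 0 ∧ v ⬝ᵥ e = 0 := by
  have h1 := finrank_le_finrank_ker_dotFunctional_add_one S e
  have h2 : LinearMap.ker (dotFunctional S e) ≠ ⊥ := fun h => by
    rw [h, finrank_bot] at h1
    omega
  obtain ⟨v, hv, hv0⟩ := Submodule.exists_mem_ne_zero_of_ne_bot h2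
  exact ⟨v, v.2, fun h => hv0 (Subtype.ext h), hv⟩

/-- The bivector `v ∧ u` as a skew-symmetric matrix. -/
def wedge (v u : Fin n → ℂ) : Matrix (Fin n) (Fin n) ℂ := vecMulVec v u - vecMulVec u v

theorem transpose_wedge (v u : Fin n → ℂ) : (wedge v u)ᵀ = -wedge v u := by
  simp [wedge, transpose_vecMulVec]

theorem wedge_mulVec (v u e : Fin n → ℂ) : wedge v u *ᵥ e = (u ⬝ᵥ e) • v - (v ⬝ᵥ e) • u := by
  simp [wedge, Matrix.sub_mulVec, vecMulVec_mulVec]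

theorem wedge_commute {A : Matrix (Fin n) (Fin n) ℂ} (hA : Aᵀ = -A) {v u : Fin n → ℂ}
    (h : wedge (A *ᵥ v) u + wedge v (A *ᵥ u) = 0) : A * wedge v u = wedge v u * A := by
  have e : ∀ w : Fin n → ℂ, w ᵥ* A = -(A *ᵥ w) := by
    intro w
    rw [← Matrix.mulVec_transpose, hA, Matrix.neg_mulVec]
  rw [← sub_eq_zero, ← h]
  simp only [wedge, Matrix.mul_sub, Matrix.sub_mul, Matrix.mul_vecMulVec, Matrix.vecMulVec_mul, e,
    vecMulVec_neg]
  abel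

theorem exists_eq_smul_of_wedge_eq_zero {v u : Fin n → ℂ} (h : wedge v u = 0) (hv : v ≠ 0) :
    ∃ α : ℂ, u = α • v := by
  obtain ⟨i, hi⟩ := Function.ne_iff.1 hv
  refine ⟨u i / v i, funext fun j => ?_⟩
  have h1 := congr_fun (congr_fun h i) j
  simp only [wedge, Matrix.sub_apply, vecMulVec_apply, Matrix.zero_apply] at h1
  have hi : v i ≠ 0 := hi
  rw [Pi.smul_apply, smul_eq_mul]
  field_simp
  linear_combination h1

theorem finrank_ker_transpose (A : Matrix (Fin n) (Fin n) ℂ) :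
    finrank ℂ (LinearMap.ker Aᵀ.mulVecLin) = finrank ℂ (LinearMap.ker A.mulVecLin) := by
  have h1 := finrank_ker_add_rank A
  have h2 := finrank_ker_add_rank Aᵀ
  rw [Matrix.rank_transpose] at h2
  omega

theorem mem_ker_sub_smul {A : Matrix (Fin n) (Fin n) ℂ} {μ : ℂ} {v : Fin n → ℂ} :
    v ∈ LinearMap.ker (A - μ • (1 : Matrix (Fin n) (Fin n) ℂ)).mulVecLin ↔ A *ᵥ v = μ • v := by
  rw [LinearMap.mem_ker, Matrix.mulVecLin_apply, Matrix.sub_mulVec, Matrix.smul_mulVec,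
    Matrix.one_mulVec, sub_eq_zero]

/-- If the eigenspace had dimension two, there would be a right and a left eigenvector `v`, `u` for
`μ`, both orthogonal to `e`. Then `v uᵀ` commutes with `A` and kills `e` on both sides. -/
theorem finrank_eigenspace_le_one_of_gl {A : Matrix (Fin n) (Fin n) ℂ} {e : Fin n → ℂ}
    (H : ∀ C : Matrix (Fin n) (Fin n) ℂ, A * C = C * A → C *ᵥ e = 0 → e ᵥ* C = 0 → C = 0) (μ : ℂ) :
    finrank ℂ (LinearMap.ker (A - μ • (1 : Matrix (Fin n) (Fin n) ℂ)).mulVecLin) ≤ 1 := by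
  by_contra hlt
  obtain ⟨v, hv, hv0, hve⟩ := exists_mem_ne_zero_dotProduct_eq_zero _ (Nat.lt_of_not_le hlt) e
  have h1 := finrank_ker_transpose (A - μ • (1 : Matrix (Fin n) (Fin n) ℂ))
  obtain ⟨u, hu, hu0, hue⟩ := exists_mem_ne_zero_dotProduct_eq_zero
    (LinearMap.ker (A - μ • (1 : Matrix (Fin n) (Fin n) ℂ))ᵀ.mulVecLin) (by omega) e
  rw [Matrix.transpose_sub, Matrix.transpose_smul, Matrix.transpose_one, mem_ker_sub_smul,
    Matrix.mulVec_transpose] at hu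
  rw [mem_ker_sub_smul] at hv
  have h2 := H (vecMulVec v u)
    (by rw [Matrix.mul_vecMulVec, Matrix.vecMulVec_mul, hv, hu, smul_vecMulVec, vecMulVec_smul])
    (by rw [vecMulVec_mulVec, hue]; simp)
    (by rw [vecMul_vecMulVec, dotProduct_comm, hve, zero_smul])
  obtain ⟨i, hi⟩ := Function.ne_iff.1 hv0
  obtain ⟨j, hj⟩ := Function.ne_iff.1 hu0
  exact mul_ne_zero hi hj (congr_fun (congr_fun h2 i) j)

section Skew

variable {A : Matrix (Fin n) (Fin n) ℂ} {e : Fin n → ℂ}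

/-- Here the transposed eigenspace belongs to `-μ`, so `v ∧ u` commutes with `A` and kills `e` when
`v`, `u` are orthogonal to `e`. It must vanish, making `v` and `u` proportional, which is impossible
for `μ ≠ -μ`. -/
theorem finrank_eigenspace_le_one_of_so (hA : Aᵀ = -A)
    (H : ∀ C : Matrix (Fin n) (Fin n) ℂ, Cᵀ = -C → A * C = C * A → C *ᵥ e = 0 → C = 0) {μ : ℂ}
    (hμ : μ ≠ 0) :
    finrank ℂ (LinearMap.ker (A - μ • (1 : Matrix (Fin n) (Fin n) ℂ)).mulVecLin) ≤ 1 := by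
  by_contra hlt
  obtain ⟨v, hv, hv0, hve⟩ := exists_mem_ne_zero_dotProduct_eq_zero _ (Nat.lt_of_not_le hlt) e
  have h1 := finrank_ker_transpose (A - μ • (1 : Matrix (Fin n) (Fin n) ℂ))
  obtain ⟨u, hu, hu0, hue⟩ := exists_mem_ne_zero_dotProduct_eq_zero
    (LinearMap.ker (A - μ • (1 : Matrix (Fin n) (Fin n) ℂ))ᵀ.mulVecLin) (by omega) e
  rw [Matrix.transpose_sub, Matrix.transpose_smul, Matrix.transpose_one, mem_ker_sub_smul, hA,
    Matrix.neg_mulVec, neg_eq_iff_eq_neg, ← neg_smul] at hu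
  rw [mem_ker_sub_smul] at hv
  have h2 := H (wedge v u) (transpose_wedge v u) (wedge_commute hA (by
    rw [hv, hu]
    simp [wedge, smul_vecMulVec, vecMulVec_smul]))
    (by rw [wedge_mulVec, hve, hue]; simp)
  obtain ⟨α, rfl⟩ := exists_eq_smul_of_wedge_eq_zero h2 hv0
  rw [Matrix.mulVec_smul, hv, smul_comm] at hu
  rw [neg_smul, ← add_eq_zero_iff_eq_neg, ← add_smul] at hu
  rcases smul_eq_zero.1 hu with h | h
  · exact hμ (by linear_combination h / 2)
  · exact hu0 h

theorem mem_span_of_mem_ker (hA : Aᵀ = -A)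
    (H : ∀ C : Matrix (Fin n) (Fin n) ℂ, Cᵀ = -C → A * C = C * A → C *ᵥ e = 0 → C = 0)
    {v u : Fin n → ℂ} (hv : A *ᵥ v = 0) (hu : A *ᵥ u = 0) (hve : v ⬝ᵥ e = 0) (hue : u ⬝ᵥ e = 0)
    (hv0 : v ≠ 0) : ∃ α : ℂ, u = α • v := by
  refine exists_eq_smul_of_wedge_eq_zero (H (wedge v u) (transpose_wedge v u)
    (wedge_commute hA ?_) ?_) hv0
  · rw [hv, hu]; simp [wedge]
  · rw [wedge_mulVec, hve, hue]; simp

theorem finrank_ker_le_two (hA : Aᵀ = -A)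
    (H : ∀ C : Matrix (Fin n) (Fin n) ℂ, Cᵀ = -C → A * C = C * A → C *ᵥ e = 0 → C = 0) :
    finrank ℂ (LinearMap.ker A.mulVecLin) ≤ 2 := by
  refine (finrank_le_finrank_ker_dotFunctional_add_one _ e).trans (Nat.add_le_add_right ?_ 1)
  by_cases hbot : LinearMap.ker (dotFunctional (LinearMap.ker A.mulVecLin) e) = ⊥
  · rw [hbot, finrank_bot]
    exact Nat.zero_le 1
  · obtain ⟨v, hv, hv0⟩ := Submodule.exists_mem_ne_zero_of_ne_bot hbot
    refine finrank_le_one (⟨v, hv⟩ : LinearMap.ker (dotFunctional (LinearMap.ker A.mulVecLin) e))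
      fun u => ?_
    obtain ⟨α, hα⟩ := mem_span_of_mem_ker hA H v.2 u.1.2 hv u.2 fun h => hv0 (Subtype.ext h)
    exact ⟨α, Subtype.ext (Subtype.ext hα.symm)⟩

theorem finrank_ker_inf_range_le_one (hA : Aᵀ = -A)
    (H : ∀ C : Matrix (Fin n) (Fin n) ℂ, Cᵀ = -C → A * C = C * A → C *ᵥ e = 0 → C = 0) :
    finrank ℂ (LinearMap.ker A.mulVecLin ⊓ LinearMap.range A.mulVecLin : Submodule ℂ (Fin n → ℂ))
      ≤ 1 := by
  by_contra hlt
  obtain ⟨v, ⟨hv, a, ha⟩, hv0, hve⟩ := exists_mem_ne_zero_dotProduct_eq_zero _ (Nat.lt_of_not_le hlt) e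
  have hv : A *ᵥ v = 0 := hv
  have ha : A *ᵥ a = v := ha
  -- A kernel vector not orthogonal to `e` exists, as otherwise the kernel is the line through `v`.
  -- It corrects the preimage `a` of `v` to a preimage `b` orthogonal to `e`, and then `v ∧ b`
  -- commutes with `A` because `Av ∧ b + v ∧ Ab = v ∧ v = 0`.
  obtain ⟨w, hw, hwe⟩ : ∃ w, A *ᵥ w = 0 ∧ w ⬝ᵥ e ≠ 0 := by
    by_contra hno
    push Not at hno
    have hle : LinearMap.ker A.mulVecLin ≤ Submodule.span ℂ {v} := fun u hu => by
      obtain ⟨α, rfl⟩ := mem_span_of_mem_ker hA H hv hu hve (hno u hu) hv0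
      exact Submodule.smul_mem _ _ (Submodule.mem_span_singleton_self v)
    have h1 := Submodule.finrank_mono (inf_le_left.trans hle : LinearMap.ker A.mulVecLin ⊓
      LinearMap.range A.mulVecLin ≤ Submodule.span ℂ {v})
    rw [finrank_span_singleton hv0] at h1
    omega
  set b := a - ((a ⬝ᵥ e) / (w ⬝ᵥ e)) • w with hb
  have hAb : A *ᵥ b = v := by
    rw [hb, Matrix.mulVec_sub, Matrix.mulVec_smul, hw, smul_zero, sub_zero, ha]
  have hbe : b ⬝ᵥ e = 0 := by
    rw [hb, sub_dotProduct, smul_dotProduct, smul_eq_mul, div_mul_cancel₀ _ hwe, sub_self]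
  obtain ⟨α, hα⟩ := exists_eq_smul_of_wedge_eq_zero (H (wedge v b) (transpose_wedge v b)
    (wedge_commute hA (by rw [hv, hAb]; simp [wedge]))
    (by rw [wedge_mulVec, hve, hbe]; simp)) hv0
  rw [hα, Matrix.mulVec_smul, hv, smul_zero] at hAb
  exact hv0 hAb.symm

end Skew

theorem ker_toLin'_sub_algebraMap (A : Matrix (Fin n) (Fin n) ℂ) (μ : ℂ) :
    LinearMap.ker (Matrix.toLin' A - algebraMap ℂ (End ℂ (Fin n → ℂ)) μ) =
      LinearMap.ker (A - μ • (1 : Matrix (Fin n) (Fin n) ℂ)).mulVecLin := by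
  ext v
  rw [mem_ker_sub_smul, LinearMap.mem_ker, LinearMap.sub_apply, Matrix.toLin'_apply,
    Module.algebraMap_end_apply, sub_eq_zero]

theorem le_natDegree_minpoly_of_finrank_ker_le_one {A : Matrix (Fin n) (Fin n) ℂ}
    (h : ∀ μ : ℂ, μ ≠ 0 →
      finrank ℂ (LinearMap.ker (A - μ • (1 : Matrix (Fin n) (Fin n) ℂ)).mulVecLin) ≤ 1)
    (h0 : finrank ℂ (LinearMap.ker A.mulVecLin) ≤ 1) : n ≤ (minpoly ℂ A).natDegree := by
  have h1 := finrank_le_natDegree_minpoly_add (Matrix.toLin' A) 0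
    (fun μ hμ => by rw [ker_toLin'_sub_algebraMap]; exact h μ hμ) fun k => by
      rw [← Matrix.toLin'_apply'] at h0
      induction k with
      | zero => rw [pow_zero, Module.End.one_eq_id, LinearMap.ker_id, finrank_bot]
      | succ k ih =>
        rw [pow_succ]
        have h2 := finrank_ker_comp_le (Matrix.toLin' A ^ k) (Matrix.toLin' A)
        omega
  rwa [Matrix.minpoly_toLin', finrank_fin_fun] at h1

/-- The kernels of the powers of `A` have dimension at most two at the first step. Each later step
adds at most `dim (ker A ⊓ range A) ≤ 1`, so `dim ker A ^ k ≤ k + 1`. -/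
theorem le_natDegree_minpoly_add_one {A : Matrix (Fin n) (Fin n) ℂ}
    (h : ∀ μ : ℂ, μ ≠ 0 →
      finrank ℂ (LinearMap.ker (A - μ • (1 : Matrix (Fin n) (Fin n) ℂ)).mulVecLin) ≤ 1)
    (h0 : finrank ℂ (LinearMap.ker A.mulVecLin) ≤ 2)
    (h1 : finrank ℂ (LinearMap.ker A.mulVecLin ⊓ LinearMap.range A.mulVecLin :
      Submodule ℂ (Fin n → ℂ)) ≤ 1) : n ≤ (minpoly ℂ A).natDegree + 1 := by
  have h1 := finrank_le_natDegree_minpoly_add (Matrix.toLin' A) 1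
    (fun μ hμ => by rw [ker_toLin'_sub_algebraMap]; exact h μ hμ) fun k => by
      rw [← Matrix.toLin'_apply'] at h0 h1
      induction k with
      | zero =>
        rw [pow_zero, Module.End.one_eq_id, LinearMap.ker_id, finrank_bot]
        exact Nat.zero_le _
      | succ k ih =>
        rcases Nat.eq_zero_or_pos k with rfl | hk
        · rwa [zero_add, pow_one]
        · rw [pow_succ']
          have h2 := finrank_ker_comp_le_inf (Matrix.toLin' A) ((Matrix.toLin' A) ^ k)
          have h3 : LinearMap.range ((Matrix.toLin' A) ^ k) ≤ LinearMap.range (Matrix.toLin' A) := by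
            obtain ⟨j, rfl⟩ := Nat.exists_eq_succ_of_ne_zero hk.ne'
            rw [Nat.succ_eq_add_one, pow_succ']
            exact LinearMap.range_comp_le_range _ _
          have h4 := Submodule.finrank_mono
            (inf_le_inf_left (LinearMap.ker (Matrix.toLin' A)) h3)
          omega
  rwa [Matrix.minpoly_toLin', finrank_fin_fun] at h1

end Eigenspaces

/-! ### The differential of the Pfaffian in corank at most two. -/

section PfaffianCorank

open Module

variable {m : ℕ}
attribute [local instance] Matrix.linftyOpNormedRing Matrix.linftyOpNormedAlgebra

theorem exists_dual_vectors {ι : Type*} [Fintype ι] [DecidableEq ι] {v : ι → Fin m → ℂ}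
    (hv : LinearIndependent ℂ v) : ∃ p : ι → Fin m → ℂ, ∀ i j, v i ⬝ᵥ p j = if i = j then 1 else 0 := by
  choose p hp using fun j => exists_dotProduct_eq hv (fun i => if i = j then (1 : ℂ) else 0)
  exact ⟨p, fun i j => hp j i⟩

/-- The Pfaffian has non-zero differential at skew-symmetric matrices of corank at most two. -/
theorem exists_fderiv_pfaffian_ne_zero (hm : Even m) (hm0 : m ≠ 0) {A : Matrix (Fin m) (Fin m) ℂ}
    (hA : Aᵀ = -A) (hker : finrank ℂ (LinearMap.ker A.mulVecLin) ≤ 2) :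
    ∃ z : Matrix (Fin m) (Fin m) ℂ, zᵀ = -z ∧ fderiv ℂ pfaffian A z ≠ 0 := by
  by_cases hdet : A.det ≠ 0
  -- The Euler direction: `a = 1` gives the derivative `m · Pf A`.
  · refine ⟨1 * A + A * (1 : Matrix (Fin m) (Fin m) ℂ)ᵀ, by simp [hA], ?_⟩
    rw [fderiv_pfaffian_infinitesimal hm, Matrix.trace_one, Fintype.card_fin]
    exact mul_ne_zero (Nat.cast_ne_zero.2 hm0) (pfaffian_ne_zero hm hA hdet)
  push Not at hdet
  have hker2 : finrank ℂ (LinearMap.ker A.mulVecLin) = 2 := by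
    obtain ⟨v, hv, hv0⟩ := Matrix.exists_mulVec_eq_zero_iff.2 hdet
    have h1 : LinearMap.ker A.mulVecLin ≠ ⊥ := fun h => hv (by
      have : v ∈ LinearMap.ker A.mulVecLin := hv0
      rwa [h, Submodule.mem_bot] at this)
    have h2 : finrank ℂ (LinearMap.ker A.mulVecLin) ≠ 0 := fun h =>
      h1 (Submodule.finrank_eq_zero.1 h)
    have h3 := finrank_ker_add_rank A
    obtain ⟨k, hk⟩ := even_rank_of_skew hA
    obtain ⟨l, hl⟩ := hm
    omega
  let b := Module.finBasisOfFinrankEq ℂ (LinearMap.ker A.mulVecLin) hker2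
  have hη : LinearIndependent ℂ fun i => (b i : Fin m → ℂ) :=
    b.linearIndependent.map' (LinearMap.ker A.mulVecLin).subtype (Submodule.ker_subtype _)
  obtain ⟨p, hp⟩ := exists_dual_vectors hη
  have hAb : ∀ i, A *ᵥ (b i : Fin m → ℂ) = 0 := fun i => (b i).2
  have hbA : ∀ i w, (b i : Fin m → ℂ) ⬝ᵥ A *ᵥ w = 0 := fun i w => by
    rw [dotProduct_mulVec_skew hA, hAb, zero_dotProduct, neg_zero]
  -- The vectors `p` are dual to a basis of the kernel, so `z` pairs the two kernel directions and
  -- makes `A + z` invertible.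
  set z := wedge (p 0) (p 1) with hz
  have hzt := transpose_wedge (p 0) (p 1)
  have hdetz : (A + z).det ≠ 0 := by
    intro h0
    obtain ⟨a, ha, ha0⟩ := Matrix.exists_mulVec_eq_zero_iff.2 h0
    rw [Matrix.add_mulVec, hz, wedge_mulVec] at ha0
    have e0 := congr_arg (fun w => (b 0 : Fin m → ℂ) ⬝ᵥ w) ha0
    have e1 := congr_arg (fun w => (b 1 : Fin m → ℂ) ⬝ᵥ w) ha0
    simp [dotProduct_add, hbA, hp, dotProduct_sub, dotProduct_smul] at e0 e1
    rw [e0, e1, zero_smul, zero_smul, sub_zero, add_zero] at ha0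
    have hrep := b.sum_repr ⟨a, ha0⟩
    rw [Fin.sum_univ_two] at hrep
    have hrep' : a = b.repr ⟨a, ha0⟩ 0 • (b 0 : Fin m → ℂ) + b.repr ⟨a, ha0⟩ 1 • (b 1 : Fin m → ℂ) :=
      (congr_arg Subtype.val hrep).symm
    generalize b.repr ⟨a, ha0⟩ 0 = s at hrep'
    generalize b.repr ⟨a, ha0⟩ 1 = t at hrep'
    rw [hrep'] at e0 e1
    rw [dotProduct_comm] at e0 e1
    simp [add_dotProduct, smul_dotProduct, hp] at e0 e1
    rw [e0, e1] at hrep'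
    exact ha (by simpa using hrep')
  refine ⟨z, hzt, ?_⟩
  -- Congruence by `1 + (t - 1) p₀ b₀ᵀ`, of determinant `t`, carries `A + z` to `A + t z`. The
  -- derivative at `A` along `z` is thus `Pf (A + z) ≠ 0`.
  have hscale : ∀ t : ℂ, pfaffian (A + t • z) = t * pfaffian (A + z) := by
    intro t
    have hg : (1 + vecMulVec ((t - 1) • p 0) (b 0)).det = t := by
      have h1 := Matrix.det_one_add_replicateCol_mul_replicateRow (ι := Unit) ((t - 1) • p 0)
        (b 0 : Fin m → ℂ)
      rw [← Matrix.vecMulVec_eq] at h1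
      rw [h1, dotProduct_smul, hp]
      simp
    have h2 := pfaffian_conj hm (1 + vecMulVec ((t - 1) • p 0) (b 0)) (A + z)
    rw [hg] at h2
    rw [← h2]
    congr 1
    have hb0 : (b 0 : Fin m → ℂ) ᵥ* A = 0 := by
      rw [← Matrix.mulVec_transpose, hA, Matrix.neg_mulVec, hAb, neg_zero]
    have hPA : vecMulVec ((t - 1) • p 0) (b 0 : Fin m → ℂ) * A = 0 := by
      rw [Matrix.vecMulVec_mul, hb0]; simp
    have hAP : A * vecMulVec (b 0 : Fin m → ℂ) ((t - 1) • p 0) = 0 := by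
      rw [Matrix.mul_vecMulVec, hAb]; simp
    have hbz : (b 0 : Fin m → ℂ) ᵥ* z = p 1 := by
      rw [hz, wedge, Matrix.vecMul_sub, vecMul_vecMulVec, vecMul_vecMulVec, hp, hp]
      simp
    have hzb : z *ᵥ (b 0 : Fin m → ℂ) = -p 1 := by
      rw [hz, wedge_mulVec, dotProduct_comm, hp, dotProduct_comm, hp]
      simp
    rw [Matrix.transpose_add, Matrix.transpose_one, transpose_vecMulVec, Matrix.add_mul,
      Matrix.one_mul, Matrix.mul_add, Matrix.mul_one, Matrix.mul_add, hPA, zero_add,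
      Matrix.vecMulVec_mul, hbz, Matrix.add_mul, Matrix.add_mul, hAP, Matrix.mul_vecMulVec, hzb,
      Matrix.vecMulVec_mul_vecMulVec]
    rw [dotProduct_comm, hp]
    simp [hz, wedge, smul_vecMulVec, vecMulVec_smul, neg_vecMulVec]
    module
  have h1 : HasDerivAt (fun t : ℂ => A + t • z) z 0 :=
    (((hasDerivAt_id (0 : ℂ)).smul_const z).const_add A).congr_deriv (by simp)
  have h2 : HasFDerivAt (pfaffian : Matrix (Fin m) (Fin m) ℂ → ℂ) (fderiv ℂ pfaffian A)
      (A + (0 : ℂ) • z) := by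
    simpa using hasFDerivAt_pfaffian A
  have h3 := h2.comp_hasDerivAt (0 : ℂ) h1
  have h4 : HasDerivAt (fun t : ℂ => t * pfaffian (A + z)) (pfaffian (A + z)) 0 := by
    simpa using (hasDerivAt_id (0 : ℂ)).mul_const (pfaffian (A + z))
  have h5 := h3.unique (h4.congr_of_eventuallyEq (Filter.Eventually.of_forall hscale))
  intro h0
  refine pfaffian_ne_zero hm ?_ hdetz (h5.symm.trans h0)
  rw [Matrix.transpose_add, hA, hzt]
  abel

end PfaffianCorank

/-! ### Gradients of the invariants and their independence. -/

section Gradients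

open Module Polynomial

attribute [local instance] Matrix.linftyOpNormedRing Matrix.linftyOpNormedAlgebra

variable {n : ℕ}

theorem coe_gradInv_gl (j : ℕ) (y : lieAlg .gl n) :
    (gradInv .gl n j y : Matrix (Fin n) (Fin n) ℂ) =
      (j : ℂ) • (y : Matrix (Fin n) (Fin n) ℂ) ^ (j - 1) := by
  obtain ⟨D, hD, hDz⟩ := hasFDerivAt_trace_pow j (y : Matrix (Fin n) (Fin n) ℂ)
  have h : gradInv .gl n j y =
      ⟨(j : ℂ) • (y : Matrix (Fin n) (Fin n) ℂ) ^ (j - 1), LieSubalgebra.mem_top _⟩ :=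
    eq_of_traceForm_eq fun z => by
      rw [traceForm_gradInv .gl n j y z hD, hDz, traceForm_apply, Matrix.smul_mul,
        Matrix.trace_smul, smul_eq_mul]
  rw [h]

theorem coe_gradInv_so_of_ne {j : ℕ} (hj : j ≠ 0) (hn : n ≠ 2 * j) (y : lieAlg .so n) :
    (gradInv .so n j y : Matrix (Fin n) (Fin n) ℂ) =
      (2 * j : ℂ) • (y : Matrix (Fin n) (Fin n) ℂ) ^ (2 * j - 1) := by
  obtain ⟨D, hD, hDz⟩ := hasFDerivAt_trace_pow (2 * j) (y : Matrix (Fin n) (Fin n) ℂ)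
  have hmem : (2 * j : ℂ) • (y : Matrix (Fin n) (Fin n) ℂ) ^ (2 * j - 1) ∈ lieAlg .so n := by
    rw [mem_lieAlg_so, Matrix.transpose_smul, Matrix.transpose_pow, transpose_coe_so,
      Odd.neg_pow ⟨j - 1, by omega⟩, smul_neg]
  have hinv : invariant .so n j = fun A => (A ^ (2 * j)).trace := by
    funext A; simp [invariant, hn]
  have h : gradInv .so n j y = ⟨_, hmem⟩ :=
    eq_of_traceForm_eq fun z => by
      rw [traceForm_gradInv .so n j y z (D := D) (by rw [hinv]; exact hD), hDz, traceForm_apply,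
        Matrix.smul_mul, Matrix.trace_smul, smul_eq_mul]
      push_cast
      rfl
  rw [h]

theorem traceForm_gradInv_pfaffian {j : ℕ} (hn : n = 2 * j) (y : lieAlg .so n)
    (z : Matrix (Fin n) (Fin n) ℂ) (hz : zᵀ = -z) :
    ((gradInv .so n j y : Matrix (Fin n) (Fin n) ℂ) * z).trace =
      fderiv ℂ pfaffian (y : Matrix (Fin n) (Fin n) ℂ) z := by
  have hinv : invariant .so n j = pfaffian := by
    funext A; simp [invariant, hn]
  exact traceForm_gradInv .so n j y ⟨z, mem_lieAlg_so.2 hz⟩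
    (by rw [hinv]; exact hasFDerivAt_pfaffian _)

theorem mul_gradInv_pfaffian {j : ℕ} (hn : n = 2 * j) (y : lieAlg .so n) :
    (y : Matrix (Fin n) (Fin n) ℂ) * (gradInv .so n j y : Matrix (Fin n) (Fin n) ℂ) =
      (pfaffian (y : Matrix (Fin n) (Fin n) ℂ) / 2) • 1 :=
  mul_pfaffian_gradient (hn ▸ even_two_mul j) (transpose_coe_so y) (transpose_coe_so _)
    (traceForm_gradInv_pfaffian hn y)

/-- The gradient of an invariant at `y` commutes with `y`. -/
theorem gradInv_commute (F : Family) {j : ℕ} (hj : j ≠ 0) (y : lieAlg F n) :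
    (y : Matrix (Fin n) (Fin n) ℂ) * (gradInv F n j y : Matrix (Fin n) (Fin n) ℂ) =
      (gradInv F n j y : Matrix (Fin n) (Fin n) ℂ) * y := by
  cases F with
  | gl => rw [coe_gradInv_gl, Matrix.mul_smul, Matrix.smul_mul, ← pow_succ, ← pow_succ']
  | so =>
    by_cases hn : n = 2 * j
    · rw [mul_gradInv_pfaffian hn y]
      exact (pfaffian_gradient_mul (hn ▸ even_two_mul j) (transpose_coe_so y) (transpose_coe_so _)
        (traceForm_gradInv_pfaffian hn y)).symm
    · rw [coe_gradInv_so_of_ne hj hn, Matrix.mul_smul, Matrix.smul_mul, ← pow_succ, ← pow_succ']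

theorem gradInv_mem_ker_ad (F : Family) {j : ℕ} (hj : j ≠ 0) (y : lieAlg F n) :
    gradInv F n j y ∈ LinearMap.ker (LieAlgebra.ad ℂ (lieAlg F n) y) :=
  mem_ker_ad.2 (gradInv_commute F hj y)

theorem linearIndependent_fin_iff {M : Type*} [AddCommGroup M] [Module ℂ M] {r : ℕ} {B : ℕ → M} :
    LinearIndependent ℂ (fun i : Fin r => B i) ↔
      ∀ c : ℕ → ℂ, ∑ i ∈ Finset.range r, c i • B i = 0 → ∀ i < r, c i = 0 := by
  rw [Fintype.linearIndependent_iff]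
  constructor
  · intro h c hc i hi
    exact h (fun i => c i) (by rwa [← Finset.sum_range (fun i => c i • B i)]) ⟨i, hi⟩
  · intro h c hc i
    have := h (fun i => if h : i < r then c ⟨i, h⟩ else 0)
      (by rw [Finset.sum_range, ← hc]; simp) i i.2
    simpa using this

theorem linearIndependent_coe_iff {F : Family} {ι : Type*} {B : ι → lieAlg F n} :
    LinearIndependent ℂ (fun i => (B i : Matrix (Fin n) (Fin n) ℂ)) ↔ LinearIndependent ℂ B :=
  LinearMap.linearIndependent_iff (lieAlg F n).toSubmodule.subtype (Submodule.ker_subtype _)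

theorem linearIndependent_pow {A : Matrix (Fin n) (Fin n) ℂ} {d : ℕ}
    (hd : d ≤ (minpoly ℂ A).natDegree) : LinearIndependent ℂ fun i : Fin d => A ^ (i : ℕ) := by
  obtain ⟨v, hv⟩ := exists_linearIndependent_pow_mulVec A hd
  exact LinearIndependent.of_comp (Matrix.mulVecBilin ℂ ℂ |>.flip v) hv

/-- The polynomial `∑ c_j 2(j+1) X ^ (2j+1)`. -/
def gradPoly (s : ℕ) (c : ℕ → ℂ) : ℂ[X] :=
  ∑ j ∈ Finset.range s, C (c j * (2 * (j + 1))) * X ^ (2 * j + 1)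

theorem natDegree_gradPoly_lt (s : ℕ) (c : ℕ → ℂ) : (gradPoly s c).natDegree ≤ 2 * s - 1 := by
  refine natDegree_sum_le_of_forall_le _ _ fun j hj => (natDegree_C_mul_X_pow_le _ _).trans ?_
  have := Finset.mem_range.1 hj
  omega

theorem coeff_gradPoly {s j : ℕ} (hj : j < s) (c : ℕ → ℂ) :
    (gradPoly s c).coeff (2 * j + 1) = c j * (2 * (j + 1)) := by
  rw [gradPoly, finsetSum_coeff, Finset.sum_eq_single j]
  · rw [coeff_C_mul_X_pow, if_pos rfl]
  · intro i _ hij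
    rw [coeff_C_mul_X_pow, if_neg (by omega)]
  · intro h
    exact absurd (Finset.mem_range.2 hj) h

theorem IsOddPoly.eq_gradPoly {p : ℂ[X]} (hp : IsOddPoly p) {s : ℕ}
    (hs : p.natDegree < 2 * s + 1) {c : ℕ → ℂ}
    (hc : ∀ j < s, c j = p.coeff (2 * j + 1) / (2 * (j + 1))) : p = gradPoly s c := by
  conv_lhs => rw [hp.eq_sum hs]
  refine Finset.sum_congr rfl fun j hj => ?_
  have h0 : (2 * ((j : ℂ) + 1)) ≠ 0 := mul_ne_zero two_ne_zero (Nat.cast_add_one_ne_zero j)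
  rw [hc j (Finset.mem_range.1 hj), div_mul_cancel₀ _ h0]

theorem eq_zero_of_gradPoly_eq_zero {s : ℕ} {c : ℕ → ℂ} (h : gradPoly s c = 0) {j : ℕ}
    (hj : j < s) : c j = 0 := by
  have h1 := coeff_gradPoly hj c
  rw [h, coeff_zero] at h1
  exact (mul_eq_zero.1 h1.symm).resolve_right
    (mul_ne_zero two_ne_zero (Nat.cast_add_one_ne_zero j))

theorem sum_gradInv_so (y : lieAlg .so n) {s : ℕ} (hs : 2 * s < n) (c : ℕ → ℂ) :
    ∑ j ∈ Finset.range s, c j • (gradInv .so n (j + 1) y : Matrix (Fin n) (Fin n) ℂ) =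
      aeval (y : Matrix (Fin n) (Fin n) ℂ) (gradPoly s c) := by
  rw [gradPoly, map_sum]
  refine Finset.sum_congr rfl fun j hj => ?_
  have := Finset.mem_range.1 hj
  rw [coe_gradInv_so_of_ne (Nat.succ_ne_zero j) (by omega), map_mul, aeval_C, map_pow, aeval_X,
    ← Algebra.smul_def, smul_smul]
  push_cast
  rfl

/-- If the differentials of the invariants are independent at `x`, the centralizer of `x` has
dimension at most the rank. -/
theorem finrank_centralizer_le_rank (F : Family) (x : lieAlg F n)
    (hx : LinearIndependent ℂ fun j : Fin (rank F n) => gradInv F n (j + 1) x) :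
    finrank ℂ (LinearMap.ker (LieAlgebra.ad ℂ (lieAlg F n) x)) ≤ rank F n := by
  rw [← linearIndependent_coe_iff,
    linearIndependent_fin_iff (B := fun j => (gradInv F n (j + 1) x : Matrix (Fin n) (Fin n) ℂ))] at hx
  cases F with
  | gl =>
    refine finrank_centralizer_gl_le ?_
    by_contra hlt
    push Not at hlt
    set A := (x : Matrix (Fin n) (Fin n) ℂ)
    have h1 := as_sum_range' (minpoly ℂ A) n hlt
    -- The gradient of `tr (x ^ (i + 1))` is `(i + 1) x ^ i`, hence the division. A minimal
    -- polynomial of degree below `n` would be a relation among the gradients.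
    have h2 := hx (fun i => (minpoly ℂ A).coeff i / (i + 1)) (by
      have h3 : aeval A (minpoly ℂ A) = 0 := minpoly.aeval ℂ A
      rw [h1, map_sum] at h3
      rw [← h3]
      refine Finset.sum_congr rfl fun i _ => ?_
      rw [coe_gradInv_gl, smul_smul, aeval_monomial, ← Algebra.smul_def]
      push_cast
      rw [div_mul_cancel₀ _ (Nat.cast_add_one_ne_zero i)])
    have h4 := h2 _ hlt
    rw [div_eq_zero_iff, or_iff_left (Nat.cast_add_one_ne_zero _)] at h4
    exact minpoly_ne_zero A (leadingCoeff_eq_zero.1 h4)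
  | so =>
    have hr : rank .so n = n / 2 := rfl
    rw [hr] at hx ⊢
    rcases Nat.even_or_odd n with hn | hn
    · rcases Nat.eq_zero_or_pos n with rfl | hpos
      · have := finrank_centralizer_so_le (x := x) (d := 0) (by omega) (Nat.zero_le _)
        omega
      obtain ⟨s, hs⟩ : ∃ s, n = 2 * (s + 1) := by
        obtain ⟨k, hk⟩ := hn
        exact ⟨k - 1, by omega⟩
      have hs2 : n / 2 = s + 1 := by omega
      have h1 := le_natDegree_minpoly_of_even hn (transpose_coe_so x)
        (transpose_coe_so (gradInv .so n (s + 1) x)) (mul_gradInv_pfaffian hs x)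
        (by
          intro p hp hpd b hb
          set c : ℕ → ℂ := fun j => if j = s then b else p.coeff (2 * j + 1) / (2 * (j + 1)) with hc
          have hpc : p = gradPoly s c := hp.eq_gradPoly (by omega) fun j hj => by
            rw [hc]; exact if_neg hj.ne
          have h2 := hx c (by
            rw [hs2, Finset.sum_range_succ, sum_gradInv_so x (by omega), ← hpc, ← hb]
            simp [hc])
          constructor
          · rw [hpc, gradPoly]
            refine Finset.sum_eq_zero fun j hj => ?_
            rw [h2 j (by have := Finset.mem_range.1 hj; omega)]
            simp
          · simpa [hc] using h2 s (by omega))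
      have h2 := finrank_centralizer_so_le (x := x) (d := n - 1) (by omega) (by omega)
      omega
    · obtain ⟨s, hs⟩ := id hn
      have hs2 : n / 2 = s := by omega
      have h1 := le_natDegree_minpoly_of_odd hn (transpose_coe_so x) (by
        intro p hp hpd hb
        have hpc : p = gradPoly s fun j => p.coeff (2 * j + 1) / (2 * (j + 1)) :=
          hp.eq_gradPoly (by omega) fun j hj => rfl
        have h2 := hx _ (by rw [hs2, sum_gradInv_so x (by omega), ← hpc, hb])
        rw [hpc, gradPoly]
        refine Finset.sum_eq_zero fun j hj => ?_
        rw [h2 j (by have := Finset.mem_range.1 hj; omega)]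
        simp)
      have h2 := finrank_centralizer_so_le (x := x) (d := n) (by omega) h1
      omega

theorem span_gradInv_eq_ker_ad (F : Family) (x : lieAlg F n)
    (hx : LinearIndependent ℂ fun j : Fin (rank F n) => gradInv F n (j + 1) x) :
    Submodule.span ℂ (Set.range fun j : Fin (rank F n) => gradInv F n (j + 1) x) =
      LinearMap.ker (LieAlgebra.ad ℂ (lieAlg F n) x) := by
  refine Submodule.eq_of_le_of_finrank_le ?_ ?_
  · rw [Submodule.span_le]
    rintro _ ⟨j, rfl⟩
    exact gradInv_mem_ker_ad F (Nat.succ_ne_zero _) x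
  · rw [finrank_span_eq_card hx, Fintype.card_fin]
    exact finrank_centralizer_le_rank F x hx

/-- If no non-zero element of the centralizer of `x` kills a vector `e` on both sides, then the
differentials of the invariants are independent at `x`. -/
theorem linearIndependent_gradInv (F : Family) (x : lieAlg F n) (e : Fin n → ℂ)
    (H : ∀ z : lieAlg F n, z ∈ LinearMap.ker (LieAlgebra.ad ℂ (lieAlg F n) x) →
      (z : Matrix (Fin n) (Fin n) ℂ) *ᵥ e = 0 → e ᵥ* (z : Matrix (Fin n) (Fin n) ℂ) = 0 → z = 0) :
    LinearIndependent ℂ fun j : Fin (rank F n) => gradInv F n (j + 1) x := by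
  rw [← linearIndependent_coe_iff,
    linearIndependent_fin_iff (B := fun j => (gradInv F n (j + 1) x : Matrix (Fin n) (Fin n) ℂ))]
  cases F with
  | gl =>
    have H' := finrank_eigenspace_le_one_of_gl (A := (x : Matrix (Fin n) (Fin n) ℂ)) (e := e)
      fun C hC h1 h2 => congr_arg Subtype.val
        (H ⟨C, LieSubalgebra.mem_top _⟩ (mem_ker_ad.2 hC) h1 h2)
    have hd := le_natDegree_minpoly_of_finrank_ker_le_one (fun μ _ => H' μ)
      (by have h0 := H' 0; rwa [zero_smul, sub_zero] at h0)
    have h1 := linearIndependent_pow hd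
    rw [linearIndependent_fin_iff (B := fun j => (x : Matrix (Fin n) (Fin n) ℂ) ^ j)] at h1
    intro c hc i hi
    have h2 := h1 (fun j => c j * (j + 1)) (by
      rw [← hc]
      refine Finset.sum_congr rfl fun j _ => ?_
      rw [coe_gradInv_gl, smul_smul]
      push_cast
      rfl) i hi
    exact (mul_eq_zero.1 h2).resolve_right (Nat.cast_add_one_ne_zero i)
  | so =>
    have hA := transpose_coe_so x
    have H' : ∀ C : Matrix (Fin n) (Fin n) ℂ, Cᵀ = -C →
        (x : Matrix (Fin n) (Fin n) ℂ) * C = C * x → C *ᵥ e = 0 → C = 0 :=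
      fun C hC hcomm h1 => congr_arg Subtype.val (H ⟨C, mem_lieAlg_so.2 hC⟩ (mem_ker_ad.2 hcomm) h1
        (by
          rw [← Matrix.mulVec_transpose]
          change Cᵀ *ᵥ e = 0
          rw [hC, Matrix.neg_mulVec, h1, neg_zero]))
    have hker := finrank_ker_le_two hA H'
    have hr : rank .so n = n / 2 := rfl
    rw [hr]
    intro c hc
    rcases Nat.even_or_odd n with hn | hn
    · rcases Nat.eq_zero_or_pos n with rfl | hpos
      · intro i hi
        omega
      obtain ⟨s, hs⟩ : ∃ s, n = 2 * (s + 1) := by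
        obtain ⟨k, hk⟩ := hn
        exact ⟨k - 1, by omega⟩
      have hd := le_natDegree_minpoly_add_one (fun μ hμ => finrank_eigenspace_le_one_of_so hA H' hμ)
        hker (finrank_ker_inf_range_le_one hA H')
      have hs2 : n / 2 = s + 1 := by omega
      rw [hs2, Finset.sum_range_succ, sum_gradInv_so x (by omega)] at hc
      obtain ⟨z, hz, hz0⟩ := exists_fderiv_pfaffian_ne_zero hn hpos.ne' hA hker
      have hG0 : (gradInv .so n (s + 1) x : Matrix (Fin n) (Fin n) ℂ) ≠ 0 := fun h0 => hz0 (by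
        rw [← traceForm_gradInv_pfaffian hs x z hz, h0, Matrix.zero_mul, Matrix.trace_zero])
      -- Multiplying the relation by `x` turns the Pfaffian gradient into a scalar, so the relation
      -- becomes `q(x) = 0` with `deg q ≤ n - 2`, below the degree of the minimal polynomial. This
      -- kills all coefficients except that of the Pfaffian gradient, which is non-zero in corank at
      -- most two.
      set q : ℂ[X] := X * gradPoly s c +
        C (c s * (pfaffian (x : Matrix (Fin n) (Fin n) ℂ) / 2)) with hq
      have hqa : aeval (x : Matrix (Fin n) (Fin n) ℂ) q = 0 := by
        have h1 := congr_arg (fun M => (x : Matrix (Fin n) (Fin n) ℂ) * M) hc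
        simp only [Matrix.mul_add, Matrix.mul_smul, Matrix.mul_zero] at h1
        rw [mul_gradInv_pfaffian hs x, smul_smul] at h1
        rw [hq, map_add, map_mul, aeval_X, aeval_C, Algebra.algebraMap_eq_smul_one]
        exact h1
      have hqd : q.natDegree ≤ 2 * s := by
        refine natDegree_add_C.le.trans ?_
        rcases eq_or_ne (gradPoly s c) 0 with h0 | h0
        · rw [h0]; simp
        · rw [natDegree_X_mul h0]
          have := natDegree_gradPoly_lt s c
          rcases Nat.eq_zero_or_pos s with rfl | hs0
          · exact absurd (by simp [gradPoly]) h0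
          · omega
      have hq0 : q = 0 := by
        by_contra hne
        exact aeval_ne_zero_of_natDegree_lt hne (by omega) hqa
      have hcs : ∀ j < s, c j = 0 := by
        intro j hj
        have h1 := congr_arg (fun r : ℂ[X] => r.coeff (2 * j + 1 + 1)) hq0
        simp only [hq, coeff_add, coeff_X_mul, coeff_C_succ, add_zero, coeff_zero] at h1
        rw [coeff_gradPoly hj] at h1
        exact (mul_eq_zero.1 h1).resolve_right
          (mul_ne_zero two_ne_zero (Nat.cast_add_one_ne_zero j))
      have hg : gradPoly s c = 0 := by
        rw [gradPoly]
        refine Finset.sum_eq_zero fun j hj => ?_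
        rw [hcs j (Finset.mem_range.1 hj)]
        simp
      rw [hg, map_zero, zero_add] at hc
      intro i hi
      rcases Nat.lt_succ_iff_lt_or_eq.1 (hs2 ▸ hi : i < s + 1) with h | rfl
      · exact hcs i h
      · exact (smul_eq_zero.1 hc).resolve_right hG0
    -- The rank is even and `n` is odd, so a kernel of dimension at most two has dimension one.
    · have hker1 : finrank ℂ (LinearMap.ker (x : Matrix (Fin n) (Fin n) ℂ).mulVecLin) ≤ 1 := by
        have h1 := finrank_ker_add_rank (x : Matrix (Fin n) (Fin n) ℂ)
        obtain ⟨k, hk⟩ := even_rank_of_skew hA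
        obtain ⟨l, hl⟩ := hn
        omega
      have hd := le_natDegree_minpoly_of_finrank_ker_le_one
        (fun μ hμ => finrank_eigenspace_le_one_of_so hA H' hμ) hker1
      obtain ⟨s, hs⟩ := id hn
      have hs2 : n / 2 = s := by omega
      rw [hs2] at hc ⊢
      rw [sum_gradInv_so x (by omega)] at hc
      have hp0 : gradPoly s c = 0 := by
        by_contra hne
        have := natDegree_gradPoly_lt s c
        exact aeval_ne_zero_of_natDegree_lt hne (by omega) hc
      exact fun i hi => eq_zero_of_gradPoly_eq_zero hp0 hi

end Gradients

/-! ### The Hamiltonian flows and the tangent space of the orbit. -/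

section Orbits

open Module

attribute [local instance] Matrix.linftyOpNormedRing Matrix.linftyOpNormedAlgebra

variable {F : Family} {n m : ℕ}

/-- The gradient of `f_{i,j}` on `𝔤ₙ`. -/
def gzGrad (F : Family) {n m : ℕ} (h : m ≤ n) (k : Index F m) (x : lieAlg F n) : lieAlg F n :=
  extend F (Nat.le_trans k.1.2 h)
    (gradInv F (k.1.1 + 1) (k.2.1 + 1) (cut F (Nat.le_trans k.1.2 h) x))

theorem gradient_gzFun (h : m ≤ n) (k : Index F m) (x : lieAlg F n) :
    gradient (gzFun F h k) x = gzGrad F h k x := by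
  have hk := Nat.le_trans k.1.2 h
  refine eq_of_traceForm_eq fun z => ?_
  rw [traceForm_gradient, gzGrad, traceForm_extend, gradInv, traceForm_gradient]
  let L : lieAlg F n →L[ℂ] lieAlg F (k.1.1 + 1) := LinearMap.toContinuousLinearMap (cut F hk)
  have h1 : HasFDerivAt (invFun F (k.1.1 + 1) (k.2.1 + 1))
      (fderiv ℂ (invFun F (k.1.1 + 1) (k.2.1 + 1)) (cut F hk x)) (L x) :=
    ((contDiff_invFun F _ _).differentiable (by simp) _).hasFDerivAt
  have h2 := HasFDerivAt.comp x h1 L.hasFDerivAt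
  exact DFunLike.congr_fun h2.fderiv z

theorem cut_lie_gzGrad (h : m ≤ n) (k : Index F m) (x : lieAlg F n) :
    cut F (Nat.le_trans k.1.2 h) ⁅x, gzGrad F h k x⁆ = 0 := by
  rw [gzGrad, cut_lie_extend]
  refine Subtype.ext ?_
  rw [coe_lie, gradInv_commute F (Nat.succ_ne_zero _), sub_self]
  rfl

/-- Along any integral curve the corner has derivative `0`, so the gradient is constant and the
equation becomes linear with constant coefficient. This shows uniqueness, so the value of
`hamiltonianFlow` does not depend on the chosen curve. -/
theorem coe_integralCurve_eq (h : m ≤ n) (k : Index F m) {x : lieAlg F n} {γ : ℂ → lieAlg F n}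
    (hγ : IsEntireIntegralCurve (hamiltonianField (gzFun F h k)) x γ) (s : ℂ) :
    (γ s : Matrix (Fin n) (Fin n) ℂ) =
      NormedSpace.exp (-(s • (gzGrad F h k x : Matrix (Fin n) (Fin n) ℂ))) * x *
        NormedSpace.exp (s • (gzGrad F h k x : Matrix (Fin n) (Fin n) ℂ)) := by
  have hk := Nat.le_trans k.1.2 h
  have hd : ∀ s, HasDerivAt γ ⁅γ s, gzGrad F h k (γ s)⁆ s := fun s => by
    have := hγ.2 s
    rwa [hamiltonianField, gradient_gzFun] at this
  have hcut : ∀ s, cut F hk (γ s) = cut F hk x := by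
    let L : lieAlg F n →L[ℂ] Matrix (Fin (k.1.1 + 1)) (Fin (k.1.1 + 1)) ℂ :=
      (inclusion F (k.1.1 + 1)).comp (LinearMap.toContinuousLinearMap (cut F hk))
    have h1 : ∀ s, HasDerivAt (fun s => L (γ s)) 0 s := fun s => by
      have h2 := HasFDerivAt.comp_hasDerivAt s (L.hasFDerivAt (x := γ s)) (hd s)
      have h3 : L ⁅γ s, gzGrad F h k (γ s)⁆ = 0 :=
        congr_arg Subtype.val (cut_lie_gzGrad h k (γ s))
      exact HasDerivAt.congr_deriv h2 h3
    intro s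
    have h4 := is_const_of_deriv_eq_zero (fun s => (h1 s).differentiableAt)
      (fun s => (h1 s).deriv) s 0
    rw [hγ.1] at h4
    exact Subtype.ext h4
  have hgrad : ∀ s, gzGrad F h k (γ s) = gzGrad F h k x := fun s => by
    rw [gzGrad, hcut, gzGrad]
  have h5 := eq_exp_conj_of_hasDerivAt (δ := fun s => inclusion F n (γ s))
    (c := (gzGrad F h k x : Matrix (Fin n) (Fin n) ℂ)) (fun s => by
      have h2 := HasFDerivAt.comp_hasDerivAt s ((inclusion F n).hasFDerivAt (x := γ s)) (hd s)
      have h3 : inclusion F n ⁅γ s, gzGrad F h k (γ s)⁆ =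
          (γ s : Matrix (Fin n) (Fin n) ℂ) * gzGrad F h k x -
            (gzGrad F h k x : Matrix (Fin n) (Fin n) ℂ) * γ s := by
        rw [hgrad, inclusion_apply, coe_lie]
      exact HasDerivAt.congr_deriv h2 h3) s
  simp only [inclusion_apply, hγ.1] at h5
  exact h5

theorem exp_conj_mem {x c : Matrix (Fin n) (Fin n) ℂ} (hx : x ∈ lieAlg F n) (hc : c ∈ lieAlg F n)
    (s : ℂ) : NormedSpace.exp (-(s • c)) * x * NormedSpace.exp (s • c) ∈ lieAlg F n := by
  cases F with
  | gl => exact LieSubalgebra.mem_top _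
  | so =>
    rw [mem_lieAlg_so] at hx hc ⊢
    rw [Matrix.transpose_mul, Matrix.transpose_mul, ← Matrix.exp_transpose, ← Matrix.exp_transpose,
      Matrix.transpose_neg, Matrix.transpose_smul, hc, hx, smul_neg, neg_neg, Matrix.neg_mul,
      Matrix.mul_neg, Matrix.mul_assoc]

/-- Conjugation by the exponential of the initial gradient is a solution: the corner of this curve
solves `δ' = [δ, g]` with `δ 0` commuting with `g`, so it is constant, and the gradient along the
curve stays the initial one. -/
theorem exists_integralCurve (h : m ≤ n) (k : Index F m) (x : lieAlg F n) :
    ∃ γ, IsEntireIntegralCurve (hamiltonianField (gzFun F h k)) x γ := by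
  have hk := Nat.le_trans k.1.2 h
  set c := gzGrad F h k x with hc
  let γ : ℂ → lieAlg F n := fun s => ⟨_, exp_conj_mem x.2 c.2 s⟩
  have hδ := hasDerivAt_exp_conj (c : Matrix (Fin n) (Fin n) ℂ) (x : Matrix (Fin n) (Fin n) ℂ)
  obtain ⟨P, hP⟩ := exists_projection F n
  have hd : ∀ s, HasDerivAt γ ⁅γ s, c⁆ s := fun s => by
    have h1 := HasFDerivAt.comp_hasDerivAt s P.hasFDerivAt (hδ s)
    have h2 : (fun s => P (NormedSpace.exp (-(s • (c : Matrix (Fin n) (Fin n) ℂ))) *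
        (x : Matrix (Fin n) (Fin n) ℂ) * NormedSpace.exp (s • (c : Matrix (Fin n) (Fin n) ℂ)))) =
        γ := funext fun s => hP (γ s)
    have h3 := hP ⁅γ s, c⁆
    rw [coe_lie] at h3
    have h4 : HasDerivAt (fun s => P (NormedSpace.exp (-(s • (c : Matrix (Fin n) (Fin n) ℂ))) *
        (x : Matrix (Fin n) (Fin n) ℂ) * NormedSpace.exp (s • (c : Matrix (Fin n) (Fin n) ℂ))))
        ⁅γ s, c⁆ s := by
      rw [← h3]
      exact h1
    rwa [h2] at h4
  have h0 : γ 0 = x := Subtype.ext (by simp [γ])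
  have hcut : ∀ s, cut F hk (γ s) = cut F hk x := by
    let L : lieAlg F n →L[ℂ] Matrix (Fin (k.1.1 + 1)) (Fin (k.1.1 + 1)) ℂ :=
      (inclusion F (k.1.1 + 1)).comp (LinearMap.toContinuousLinearMap (cut F hk))
    let g := gradInv F (k.1.1 + 1) (k.2.1 + 1) (cut F hk x)
    intro s
    have h1 := eq_const_of_hasDerivAt (δ := fun s => L (γ s))
      (c := (g : Matrix (Fin (k.1.1 + 1)) (Fin (k.1.1 + 1)) ℂ)) (fun s => by
        have h2 := HasFDerivAt.comp_hasDerivAt s (L.hasFDerivAt (x := γ s)) (hd s)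
        have h3 : L ⁅γ s, c⁆ =
            (cut F hk (γ s) : Matrix (Fin (k.1.1 + 1)) (Fin (k.1.1 + 1)) ℂ) *
                (g : Matrix (Fin (k.1.1 + 1)) (Fin (k.1.1 + 1)) ℂ) -
              (g : Matrix (Fin (k.1.1 + 1)) (Fin (k.1.1 + 1)) ℂ) * cut F hk (γ s) := by
          rw [← coe_lie, ← cut_lie_extend]
          rfl
        exact HasDerivAt.congr_deriv h2 h3) (by
        simp only [h0]
        exact gradInv_commute F (Nat.succ_ne_zero _) (cut F hk x)) s
    simp only [h0] at h1
    exact Subtype.ext h1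
  refine ⟨γ, h0, fun s => ?_⟩
  have hgrad : gzGrad F h k (γ s) = c := by
    rw [hc, gzGrad, hcut, gzGrad]
  rw [hamiltonianField, gradient_gzFun, hgrad]
  exact hd s

theorem coe_hamiltonianFlow (h : m ≤ n) (k : Index F m) (t : ℂ) (x : lieAlg F n) :
    (hamiltonianFlow (gzFun F h k) t x : Matrix (Fin n) (Fin n) ℂ) =
      NormedSpace.exp (-(t • (gzGrad F h k x : Matrix (Fin n) (Fin n) ℂ))) * x *
        NormedSpace.exp (t • (gzGrad F h k x : Matrix (Fin n) (Fin n) ℂ)) := by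
  rw [hamiltonianFlow, dif_pos (exists_integralCurve h k x)]
  exact coe_integralCurve_eq h k (exists_integralCurve h k x).choose_spec t

theorem hamiltonianFlow_zero (h : m ≤ n) (k : Index F m) (x : lieAlg F n) :
    hamiltonianFlow (gzFun F h k) 0 x = x :=
  Subtype.ext (by rw [coe_hamiltonianFlow]; simp)

theorem differentiable_gzGrad (h : m ≤ n) (k : Index F m) :
    Differentiable ℂ fun x => inclusion F n (gzGrad F h k x) := by
  have hk := Nat.le_trans k.1.2 h
  let L : lieAlg F n →L[ℂ] lieAlg F (k.1.1 + 1) := LinearMap.toContinuousLinearMap (cut F hk)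
  let M : lieAlg F (k.1.1 + 1) →L[ℂ] Matrix (Fin n) (Fin n) ℂ :=
    (inclusion F n).comp (LinearMap.toContinuousLinearMap (extend F hk))
  have h1 : Differentiable ℂ fun x => M (gradInv F (k.1.1 + 1) (k.2.1 + 1) (L x)) :=
    M.differentiable.comp ((differentiable_gradInv F _ _).comp L.differentiable)
  exact h1

theorem hasFDerivAt_hamiltonianFlow (h : m ≤ n) (k : Index F m) (x : lieAlg F n) :
    HasFDerivAt (fun p : ℂ × lieAlg F n => hamiltonianFlow (gzFun F h k) p.1 p.2)
      ((ContinuousLinearMap.fst ℂ ℂ (lieAlg F n)).smulRight ⁅x, gzGrad F h k x⁆ +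
        ContinuousLinearMap.snd ℂ ℂ (lieAlg F n)) (0, x) := by
  obtain ⟨P, hP⟩ := exists_projection F n
  have h1 := hasFDerivAt_exp_conj_zero (differentiable_gzGrad h k x) (inclusion F n)
  have h2 := HasFDerivAt.comp (0, x) P.hasFDerivAt h1
  have h3 : (fun p : ℂ × lieAlg F n => hamiltonianFlow (gzFun F h k) p.1 p.2) =
      P ∘ fun p : ℂ × lieAlg F n => NormedSpace.exp (-(p.1 • inclusion F n (gzGrad F h k p.2))) *
        inclusion F n p.2 * NormedSpace.exp (p.1 • inclusion F n (gzGrad F h k p.2)) := by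
    funext p
    simp only [Function.comp_apply, inclusion_apply]
    rw [← coe_hamiltonianFlow, hP]
  rw [h3]
  refine HasFDerivAt.congr_fderiv h2 ?_
  refine ContinuousLinearMap.ext fun p => ?_
  have h4 := hP ⁅x, gzGrad F h k x⁆
  rw [coe_lie] at h4
  have h5 : P (p.1 • ((x : Matrix (Fin n) (Fin n) ℂ) * (gzGrad F h k x : Matrix (Fin n) (Fin n) ℂ) -
      (gzGrad F h k x : Matrix (Fin n) (Fin n) ℂ) * x) + (p.2 : Matrix (Fin n) (Fin n) ℂ)) =
      p.1 • ⁅x, gzGrad F h k x⁆ + p.2 := by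
    rw [map_add, map_smul, h4, hP]
  exact h5

theorem nodup_indexList (F : Family) (m : ℕ) : (indexList F m).Nodup := by
  refine List.nodup_flatMap.2 ⟨fun i _ => (List.nodup_finRange _).map fun a b h => ?_, ?_⟩
  · simpa using h
  · refine (List.nodup_finRange m).imp fun {i j} hij => ?_
    simp only [Function.onFun, List.disjoint_left, List.mem_map]
    rintro _ ⟨a, -, rfl⟩ ⟨b, -, h⟩
    exact hij (congr_arg Sigma.fst h).symm

theorem mem_indexList (k : Index F m) : k ∈ indexList F m :=
  List.mem_flatMap.2 ⟨k.1, List.mem_finRange _, List.mem_map.2 ⟨k.2, List.mem_finRange _, rfl⟩⟩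

theorem sum_indexList {M : Type*} [AddCommMonoid M] (f : Index F m → M) :
    ((indexList F m).map f).sum = ∑ k, f k := by
  classical
  rw [← List.sum_toFinset f (nodup_indexList F m)]
  exact Finset.sum_congr (Finset.eq_univ_of_forall fun k => List.mem_toFinset.2 (mem_indexList k))
    fun _ _ => rfl

/-- To first order at `0` a composition of flows is the sum of the vector fields, whatever the order
of composition. -/
theorem orbitTangentSpace_eq (x : lieAlg F n) :
    orbitTangentSpace x = Submodule.span ℂ (Set.range fun k : Index F (n - 1) =>
      ⁅x, gzGrad F (Nat.sub_le n 1) k x⁆) := by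
  have h1 := (hasFDerivAt_foldr_flow
    (Φ := fun (k : Index F (n - 1)) (p : ℂ × lieAlg F n) =>
      hamiltonianFlow (gzFun F (Nat.sub_le n 1) k) p.1 p.2)
    (ξ := fun k => ⁅x, gzGrad F (Nat.sub_le n 1) k x⁆) (x := x)
    (fun k => hamiltonianFlow_zero _ k x) (fun k => hasFDerivAt_hamiltonianFlow _ k x)
    (indexList F (n - 1))).2
  have h2 := h1.fderiv
  have h3 : ∀ t : GroupA F n, fderiv ℂ (fun t : GroupA F n => act t x) 0 t =
      ∑ k, t k • ⁅x, gzGrad F (Nat.sub_le n 1) k x⁆ := by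
    intro t
    refine (DFunLike.congr_fun h2 t).trans ?_
    rw [sum_indexList]
    exact _root_.sum_apply _ _ _
  refine SetLike.ext fun z => ?_
  rw [Submodule.mem_span_range_iff_exists_fun]
  constructor
  · rintro ⟨t, rfl⟩
    exact ⟨t, (h3 t).symm⟩
  · rintro ⟨t, rfl⟩
    exact ⟨t, h3 t⟩

end Orbits

/-! ### A regular element, and the dimension count for `d`. -/

section RegularElement

open Module

variable {n : ℕ}

theorem finrank_ker_ad_eq_rank (F : Family) (x : lieAlg F n)
    (hx : LinearIndependent ℂ fun j : Fin (rank F n) => gradInv F n (j + 1) x) :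
    finrank ℂ (LinearMap.ker (LieAlgebra.ad ℂ (lieAlg F n) x)) = rank F n := by
  rw [← span_gradInv_eq_ker_ad F x hx, finrank_span_eq_card hx, Fintype.card_fin]

/-- The skew-symmetric tridiagonal matrix sending `e_k` to `e_{k+1} - e_{k-1}`. -/
def tridiag (n : ℕ) : Matrix (Fin n) (Fin n) ℂ :=
  Matrix.of fun i j => if i.1 = j.1 + 1 then 1 else if j.1 = i.1 + 1 then -1 else 0

theorem tridiag_mem (F : Family) (n : ℕ) : tridiag n ∈ lieAlg F n := by
  cases F with
  | gl => exact LieSubalgebra.mem_top _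
  | so =>
    rw [mem_lieAlg_so]
    ext i j
    simp only [tridiag, Matrix.transpose_apply, Matrix.neg_apply, Matrix.of_apply]
    split_ifs <;> first | omega | simp

theorem tridiag_col_zero (h : 1 < n) :
    (tridiag n).col ⟨0, by omega⟩ = Pi.single ⟨1, h⟩ 1 := by
  ext i
  simp only [Matrix.col, Matrix.transpose_apply, tridiag, Matrix.of_apply, Pi.single_apply,
    Fin.ext_iff]
  split_ifs <;> first | omega | rfl | (exfalso; assumption)

theorem tridiag_col_succ {k : ℕ} (h : k + 2 < n) :
    (tridiag n).col ⟨k + 1, by omega⟩ =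
      Pi.single ⟨k + 2, h⟩ 1 - Pi.single ⟨k, by omega⟩ 1 := by
  ext i
  simp only [Matrix.col, Matrix.transpose_apply, tridiag, Matrix.of_apply, Pi.sub_apply,
    Pi.single_apply, Fin.ext_iff]
  split_ifs <;> first | omega | simp

/-- The first basis vector is cyclic for `tridiag n`. -/
theorem eq_zero_of_commute_tridiag {z : Matrix (Fin n) (Fin n) ℂ}
    (hz : tridiag n * z = z * tridiag n) (h0 : ∀ i : Fin n, i.1 = 0 → z *ᵥ Pi.single i 1 = 0) :
    z = 0 := by
  have hcol : ∀ i : Fin n, z *ᵥ Pi.single i 1 = 0 → z *ᵥ (tridiag n).col i = 0 := fun i hi => by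
    rw [← Matrix.mulVec_single_one, Matrix.mulVec_mulVec, ← hz, ← Matrix.mulVec_mulVec, hi,
      Matrix.mulVec_zero]
  have h : ∀ k : ℕ, ∀ hk : k < n, z *ᵥ Pi.single ⟨k, hk⟩ 1 = 0 := by
    intro k
    induction k using Nat.strong_induction_on with
    | _ k ih =>
      match k with
      | 0 => exact fun hk => h0 _ rfl
      | 1 =>
        intro hk
        rw [← tridiag_col_zero hk]
        exact hcol _ (h0 _ rfl)
      | k + 2 =>
        intro hk
        have h1 := hcol _ (ih (k + 1) (by omega) (by omega))
        rw [tridiag_col_succ hk, Matrix.mulVec_sub, ih k (by omega) (by omega), sub_zero] at h1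
        exact h1
  refine Matrix.ext_of_mulVec_single fun i => ?_
  rw [h i.1 i.2, Matrix.zero_mulVec]

theorem exists_isRegular (F : Family) (n : ℕ) : ∃ y : lieAlg F n, IsRegular y := by
  refine ⟨⟨tridiag n, tridiag_mem F n⟩, finrank_ker_ad_eq_rank F _ ?_⟩
  -- This is the first basis vector, written so that `n = 0` is allowed. It is cyclic for `tridiag
  -- n`, so a centralizing element killing it is zero.
  refine linearIndependent_gradInv F _ (fun i => if i.1 = 0 then 1 else 0) fun z hz hze _ => ?_
  refine Subtype.ext (eq_zero_of_commute_tridiag (mem_ker_ad.1 hz) fun i hi => ?_)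
  rw [← hze]
  congr 1
  ext j
  simp only [Pi.single_apply, Fin.ext_iff, hi]

theorem finrank_so (n : ℕ) : finrank ℂ (lieAlg .so n) = ∑ i ∈ Finset.range n, i := by
  let e : lieAlg .so n ≃ₗ[ℂ] ((Σ i : Fin n, Fin i.1) → ℂ) :=
    { toFun := fun z p => (z : Matrix (Fin n) (Fin n) ℂ) p.1 (p.2.castLE p.1.2.le)
      map_add' := fun _ _ => rfl
      map_smul' := fun _ _ => rfl
      invFun := fun f => ⟨Matrix.of fun i j =>
        if h : j.1 < i.1 then f ⟨i, ⟨j.1, h⟩⟩ else if h : i.1 < j.1 then -f ⟨j, ⟨i.1, h⟩⟩ else 0, by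
          rw [mem_lieAlg_so]
          ext i j
          simp only [Matrix.transpose_apply, Matrix.neg_apply, Matrix.of_apply]
          split_ifs <;> first | omega | simp⟩
      left_inv := fun z => by
        refine Subtype.ext (Matrix.ext fun i j => ?_)
        have hs : ∀ a b, (z : Matrix (Fin n) (Fin n) ℂ) b a = -(z : Matrix (Fin n) (Fin n) ℂ) a b :=
          fun a b => congr_fun (congr_fun (transpose_coe_so z) a) b
        simp only [Matrix.of_apply]
        split_ifs with h1 h2
        · rfl
        · exact (hs j i).symm
        · have hij : i = j := Fin.ext (by omega)
          subst hij
          exact (self_eq_neg.1 (hs i i)).symm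
      right_inv := fun f => by
        funext ⟨i, j⟩
        exact dif_pos j.2 }
  rw [e.finrank_eq, finrank_fintype_fun_eq_card, Fintype.card_sigma, ← Fin.sum_univ_eq_sum_range]
  simp

theorem finrank_lieAlg (F : Family) (n : ℕ) :
    finrank ℂ (lieAlg F n) = 2 * ∑ i ∈ Finset.range n, rank F i + rank F n := by
  cases F with
  | gl =>
    have h : finrank ℂ (lieAlg .gl n) = n * n := by
      have h1 : finrank ℂ (lieAlg .gl n).toSubmodule = n * n := by
        rw [show (lieAlg .gl n).toSubmodule = ⊤ from rfl, finrank_top, finrank_matrix]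
        simp
      exact h1
    have h1 := Finset.sum_range_id_mul_two n
    rw [h, mul_comm 2]
    simp only [rank]
    rw [h1]
    cases n with
    | zero => rfl
    | succ n => rw [Nat.add_sub_cancel, Nat.mul_succ]
  | so =>
    rw [finrank_so]
    induction n with
    | zero => rfl
    | succ n ih =>
      rw [Finset.sum_range_succ, Finset.sum_range_succ, ih]
      simp only [rank]
      omega

theorem card_index (F : Family) (n : ℕ) :
    Fintype.card (Index F (n - 1)) = ∑ i ∈ Finset.range n, rank F i := by
  rw [Fintype.card_sigma]
  cases n with
  | zero => rfl
  | succ n =>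
    have h0 : rank F 0 = 0 := by cases F <;> rfl
    rw [Finset.sum_range_succ', h0, ← Fin.sum_univ_eq_sum_range (fun i => rank F (i + 1))]
    simp

/-- By rank-nullity all regular orbits have dimension `dim 𝔤ₙ - r_n = 2 ∑_{i<n} r_i`. The existence
of a regular element is needed so that the supremum is not over the empty set. -/
theorem halfRegularOrbitDim_eq (F : Family) (n : ℕ) :
    halfRegularOrbitDim F n = Fintype.card (Index F (n - 1)) := by
  have h1 : ∀ y : lieAlg F n, IsRegular y →
      adjointOrbitDim y = 2 * ∑ i ∈ Finset.range n, rank F i := fun y hy => by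
    have h2 := LinearMap.finrank_range_add_finrank_ker (LieAlgebra.ad ℂ (lieAlg F n) y)
    rw [finrank_lieAlg, hy] at h2
    exact Nat.add_right_cancel h2
  have h3 : {m : ℕ | ∃ y : lieAlg F n, IsRegular y ∧ adjointOrbitDim y = m} =
      {2 * ∑ i ∈ Finset.range n, rank F i} := by
    ext m
    constructor
    · rintro ⟨y, hy, rfl⟩
      exact h1 y hy
    · rintro rfl
      obtain ⟨y, hy⟩ := exists_isRegular F n
      exact ⟨y, hy, h1 y hy⟩
  rw [halfRegularOrbitDim, h3, csSup_singleton, card_index]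
  omega

end RegularElement

/-! ### Comparison of strong regularity with the orbit dimension. -/

section Main

open Module Submodule

variable {F : Family} {n m : ℕ}

theorem orbitDim_le (x : lieAlg F n) : orbitDim x ≤ halfRegularOrbitDim F n := by
  rw [orbitDim, orbitTangentSpace_eq, halfRegularOrbitDim_eq]
  exact finrank_range_le_card _

theorem orbitDim_eq_iff (x : lieAlg F n) : orbitDim x = halfRegularOrbitDim F n ↔
    LinearIndependent ℂ fun k : Index F (n - 1) => ⁅x, gzGrad F (Nat.sub_le n 1) k x⁆ := by
  rw [orbitDim, orbitTangentSpace_eq, halfRegularOrbitDim_eq,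
    linearIndependent_iff_card_eq_finrank_span, eq_comm]
  rfl

theorem stronglyRegular_iff (x : lieAlg F n) : StronglyRegular F n x ↔
    LinearIndependent ℂ fun k : Index F n => gzGrad F le_rfl k x := by
  let e : (lieAlg F n →L[ℂ] ℂ) →ₗ[ℂ] lieAlg F n :=
    (((traceForm F n).toDual (traceForm_nondegenerate F n)).symm : _ →ₗ[ℂ] lieAlg F n).comp
      (ContinuousLinearMap.coeLM ℂ)
  have he : LinearMap.ker e = ⊥ := LinearMap.ker_eq_bot.2
    (((traceForm F n).toDual (traceForm_nondegenerate F n)).symm.injective.comp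
      ContinuousLinearMap.coe_injective)
  have h : (fun k : Index F n => gzGrad F le_rfl k x) =
      e ∘ fun k : Index F n => fderiv ℂ (gzFun F le_rfl k) x :=
    funext fun k => (gradient_gzFun le_rfl k x).symm
  rw [h]
  exact (LinearMap.linearIndependent_iff e he).symm

theorem cut_self (x : lieAlg F n) : cut F le_rfl x = x := rfl

theorem extend_self (x : lieAlg F n) : extend F le_rfl x = x := by
  have h := extend_injective F (le_refl n)
  have h1 := cut_extend F (le_refl n) x
  rwa [cut_self] at h1

/-- The index set for `m + 1` is the one for `m` and the indices of the invariants of `𝔤ₘ₊₁`. -/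
def indexSuccEquiv (F : Family) (m : ℕ) :
    Index F m ⊕ Fin (rank F (m + 1)) ≃ Index F (m + 1) :=
  Equiv.ofBijective (Sum.elim (fun k => ⟨k.1.castSucc, k.2⟩) fun j => ⟨Fin.last m, j⟩) <| by
    constructor
    · rintro (⟨i, j⟩ | j) (⟨i', j'⟩ | j') h
      · simp only [Sum.elim_inl, Sigma.mk.injEq, Fin.castSucc_inj] at h
        obtain ⟨rfl, h⟩ := h
        rw [eq_of_heq h]
      · exact absurd (congr_arg Sigma.fst h) (Fin.castSucc_ne_last i)
      · exact absurd (congr_arg Sigma.fst h).symm (Fin.castSucc_ne_last i')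
      · exact congr_arg Sum.inr (sigma_mk_injective (i := Fin.last m) h)
    · rintro ⟨i, j⟩
      induction i using Fin.lastCases with
      | last => exact ⟨Sum.inr j, rfl⟩
      | cast i => exact ⟨Sum.inl ⟨i, j⟩, rfl⟩

theorem linearIndependent_gzGrad_succ_iff (x : lieAlg F (m + 1)) :
    (LinearIndependent ℂ fun k : Index F (m + 1) => gzGrad F le_rfl k x) ↔
      (LinearIndependent ℂ fun k : Index F m => gzGrad F (Nat.le_succ m) k x) ∧
      (LinearIndependent ℂ fun j : Fin (rank F (m + 1)) => gradInv F (m + 1) (j + 1) x) ∧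
      Disjoint (span ℂ (Set.range fun k : Index F m => gzGrad F (Nat.le_succ m) k x))
        (span ℂ (Set.range fun j : Fin (rank F (m + 1)) => gradInv F (m + 1) (j + 1) x)) := by
  rw [← linearIndependent_equiv (indexSuccEquiv F m), linearIndependent_sum]
  have h : ((fun k : Index F (m + 1) => gzGrad F le_rfl k x) ∘ indexSuccEquiv F m) ∘ Sum.inr =
      fun j : Fin (rank F (m + 1)) => gradInv F (m + 1) (j + 1) x :=
    funext fun j => extend_self (gradInv F (m + 1) (j + 1) x)
  rw [h]
  rfl

/-- The brackets are the images of the gradients under `ad x`, so independence means that `ad x` is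
injective on their span. -/
theorem linearIndependent_lie_gzGrad_iff (x : lieAlg F (m + 1)) :
    (LinearIndependent ℂ fun k : Index F m => ⁅x, gzGrad F (Nat.le_succ m) k x⁆) ↔
      (LinearIndependent ℂ fun k : Index F m => gzGrad F (Nat.le_succ m) k x) ∧
      Disjoint (span ℂ (Set.range fun k : Index F m => gzGrad F (Nat.le_succ m) k x))
        (LinearMap.ker (LieAlgebra.ad ℂ (lieAlg F (m + 1)) x)) := by
  have h : (fun k : Index F m => ⁅x, gzGrad F (Nat.le_succ m) k x⁆) =
      LieAlgebra.ad ℂ (lieAlg F (m + 1)) x ∘ fun k => gzGrad F (Nat.le_succ m) k x := rfl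
  rw [h]
  exact ⟨fun h => ⟨h.of_comp _, range_ker_disjoint h⟩, fun h => h.1.map h.2⟩

theorem extend_cut_of_last {z : lieAlg F (m + 1)}
    (hc : (z : Matrix (Fin (m + 1)) (Fin (m + 1)) ℂ) *ᵥ Pi.single (Fin.last m) 1 = 0)
    (hr : Pi.single (Fin.last m) 1 ᵥ* (z : Matrix (Fin (m + 1)) (Fin (m + 1)) ℂ) = 0) :
    extend F (Nat.le_succ m) (cut F (Nat.le_succ m) z) = z := by
  rw [Matrix.mulVec_single_one] at hc
  rw [Matrix.single_one_vecMul] at hr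
  refine Subtype.ext (Matrix.ext fun i j => ?_)
  rw [coe_extend, coe_cut]
  have hi : ∀ (i : Fin m), firstCoords (Nat.le_succ m) i.castSucc = Pi.single i 1 := fun i => by
    ext a
    simp [firstCoords, Matrix.one_apply, Pi.single_apply, Fin.ext_iff, eq_comm]
  have hl : firstCoords (Nat.le_succ m) (Fin.last m) = 0 := by
    ext a
    simp [firstCoords, Fin.ext_iff, a.2.ne']
  induction i using Fin.lastCases with
  | last =>
    rw [Matrix.mul_assoc, Matrix.mul_apply, hl]
    simpa using (congr_fun hr j).symm
  | cast i =>
    induction j using Fin.lastCases with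
    | last =>
      rw [Matrix.mul_apply]
      simp only [Matrix.transpose_apply, hl]
      simpa using (congr_fun hc i.castSucc).symm
    | cast j =>
      simp only [Matrix.mul_apply, Matrix.transpose_apply, hi, Pi.single_apply]
      simp
      rfl

/-- The gradients of the invariants of `𝔤ₘ` are among the gradients of the `f_{i,j}`, `i ≤ m`. -/
theorem range_extend_gradInv_subset (x : lieAlg F n) (h : m ≤ n) :
    ∃ σ : Fin (rank F m) → Index F m, Function.Injective σ ∧ ∀ j : Fin (rank F m),
      extend F h (gradInv F m (j + 1) (cut F h x)) = gzGrad F h (σ j) x := by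
  cases m with
  | zero =>
    have h0 : rank F 0 = 0 := by cases F <;> rfl
    have : IsEmpty (Fin (rank F 0)) := by rw [h0]; infer_instance
    exact ⟨isEmptyElim, fun j => isEmptyElim j, fun j => isEmptyElim j⟩
  | succ m => exact ⟨fun j => ⟨Fin.last m, j⟩, fun _ _ h => sigma_mk_injective (i := Fin.last m) h, fun j => rfl⟩

theorem linearIndependent_gradInv_of_lie {x : lieAlg F (m + 1)}
    (hx : LinearIndependent ℂ fun k : Index F m => ⁅x, gzGrad F (Nat.le_succ m) k x⁆) :
    LinearIndependent ℂ fun j : Fin (rank F (m + 1)) => gradInv F (m + 1) (j + 1) x := by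
  obtain ⟨hli, hdisj⟩ := (linearIndependent_lie_gzGrad_iff x).1 hx
  obtain ⟨σ, hσ, hσx⟩ := range_extend_gradInv_subset x (Nat.le_succ m)
  have hli' : LinearIndependent ℂ fun j : Fin (rank F m) =>
      gradInv F m (j + 1) (cut F (Nat.le_succ m) x) := by
    have h1 := hli.comp σ hσ
    rw [show (fun k : Index F m => gzGrad F (Nat.le_succ m) k x) ∘ σ =
      extend F (Nat.le_succ m) ∘ fun j : Fin (rank F m) =>
        gradInv F m (j + 1) (cut F (Nat.le_succ m) x) from funext fun j => (hσx j).symm] at h1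
    exact h1.of_comp _
  refine linearIndependent_gradInv F x (Pi.single (Fin.last m) 1) fun z hz hc hr => ?_
  -- Since the last row and column of `z` vanish, `z` is determined by its corner. The corner
  -- commutes with that of `x`, hence is a combination of the gradients one level down, and so `z`
  -- lies both in the span of the lower gradients and in the centralizer.
  have hez := extend_cut_of_last hc hr
  have hcz : cut F (Nat.le_succ m) z ∈
      LinearMap.ker (LieAlgebra.ad ℂ (lieAlg F m) (cut F (Nat.le_succ m) x)) := by
    rw [LinearMap.mem_ker, LieAlgebra.ad_apply, ← cut_lie_extend, hez]
    rw [LinearMap.mem_ker, LieAlgebra.ad_apply] at hz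
    rw [hz, map_zero]
  rw [← span_gradInv_eq_ker_ad F _ hli'] at hcz
  refine Submodule.disjoint_def.1 hdisj z ?_ hz
  have h2 := Submodule.mem_map_of_mem (f := extend F (Nat.le_succ m)) hcz
  rw [hez, Submodule.map_span] at h2
  refine span_mono ?_ h2
  rintro _ ⟨_, ⟨j, rfl⟩, rfl⟩
  exact ⟨σ j, (hσx j).symm⟩

theorem stronglyRegular_iff_orbitDim_eq (x : lieAlg F n) :
    StronglyRegular F n x ↔ orbitDim x = halfRegularOrbitDim F n := by
  rw [stronglyRegular_iff, orbitDim_eq_iff]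
  cases n with
  | zero =>
    have : IsEmpty (Index F 0) := ⟨fun k => k.1.elim0⟩
    have : IsEmpty (Index F (0 - 1)) := ⟨fun k => k.1.elim0⟩
    exact ⟨fun _ => linearIndependent_empty_type, fun _ => linearIndependent_empty_type⟩
  | succ m =>
    rw [linearIndependent_gzGrad_succ_iff]
    refine Iff.trans ?_ (linearIndependent_lie_gzGrad_iff x).symm
    constructor
    · rintro ⟨h1, h2, h3⟩
      rw [span_gradInv_eq_ker_ad F x h2] at h3
      exact ⟨h1, h3⟩
    · intro h
      have h2 := linearIndependent_gradInv_of_lie ((linearIndependent_lie_gzGrad_iff x).2 h)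
      refine ⟨h.1, h2, ?_⟩
      rw [span_gradInv_eq_ker_ad F x h2]
      exact h.2

end Main

end GelfandZeitlin

end

theorem mainTheorem7 (F : GelfandZeitlin.Family) (n : ℕ) (x : GelfandZeitlin.lieAlg F n) :
    GelfandZeitlin.orbitDim x ≤ GelfandZeitlin.halfRegularOrbitDim F n ∧
      (GelfandZeitlin.StronglyRegular F n x ↔
        GelfandZeitlin.orbitDim x = GelfandZeitlin.halfRegularOrbitDim F n) :=
  ⟨GelfandZeitlin.orbitDim_le x, GelfandZeitlin.stronglyRegular_iff_orbitDim_eq x⟩
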